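/- Let $A$ and $B$ be quantum systems of finite dimensions $d_A$ and $d_B$, let $d=\min\{d_A,d_B\}$, and let $|\psi\rangle\in\mathbb{C}^{d_A}\otimes\mathbb{C}^{d_B}$ be a unit vector with $\psi=|\psi\rangle\langle\psi|$. Let $|\xi_\psi\rangle=(\alpha_1,\dots,\alpha_d)^T$ be the vector of its Schmidt coefficients: $\alpha_i\ge 0$ and $|\psi\rangle=\sum_{i=1}^d\alpha_i|e_i\rangle\otimes|f_i\rangle$ for some orthonormal families $(e_i)$ in $\mathbb{C}^{d_A}$ and $(f_i)$ in $\mathbb{C}^{d_B}$. For an integer $m\ge 1$ put $|\Psi_m\rangle=\frac1{\sqrt m}\sum_{i=1}^m|ii\rangle\in\mathbb{C}^m\otimes\mathbb{C}^m$ and $\Psi_m=|\Psi_m\rangle\langle\Psi_m|$. For a class $\mathcal O$ of completely positive trace-preserving (CPTP) maps define the fidelity of distillation $$F_{\mathcal O}(\rho,m)=\sup_{\Lambda\in\mathcal O}\operatorname{Tr}\big(\Lambda(\rho)\,\Psi_m\big),$$ where $\Lambda$ runs over the maps in $\mathcal O$ from $AB$ to $A'B'$ with $A'=B'=\mathbb{C}^m$.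 For $x\in\mathbb{C}^d$ define the $m$-distillation norm $$\|x\|_{[m]}=\min_{x=y+z}\ \|y\|_{\ell_1}+\sqrt m\,\|z\|_{\ell_2}.$$ Then, for every such $\psi$, every integer $m\ge 1$, and every class $\mathcal O\in\{1\text{-LOCC},\ \text{LOCC},\ \text{PPT},\ \text{Rains-preserving},\ \mathsf{PPT}_+\text{-preserving},\ \text{SEPP}\}$, $$F_{\mathcal O}(\psi,m)=\frac1m\,\big\|\,|\xi_\psi\rangle\big\|_{[m]}^2 .$$ Here the classes consist of the following maps $\Lambda:AB\to A'B'$. - 1-LOCC: $\Lambda=\sum_i E_i\otimes F_i$ (a finite sum) with $E_i:A\to A'$ completely positive, $\sum_iE_i$ trace-preserving, and each $F_i:B\to B'$ CPTP (communication from $A$ to $B$). - LOCC: maps realised by finitely many rounds, in each of which one party applies a finite-outcome instrument to its system and announces the outcome, on which all later steps may depend, followed by local CPTP maps. - PPT: CPTP maps whose Choi matrix satisfies $J_\Lambda^{T_{BB'}}\succeq 0$. - Rains-preserving: CPTP maps that send the set $\{X\succeq 0:\|X^{T_B}\|_1\le 1\}$ of $AB$ into that of $A'B'$. - $\mathsf{PPT}_+$-preserving: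 CPTP maps that send the set $\{X\succeq 0:\operatorname{Tr}X=1,\ X^{T_B}\succeq 0\}$ of $AB$ into that of $A'B'$. - SEPP: CPTP maps that send separable states (convex combinations of pure product states) of $AB$ to separable states of $A'B'$. -/

import Mathlib

open scoped MatrixOrder ComplexOrder

noncomputable section

namespace Distillation

/-- Linear maps between spaces of complex square matrices. -/
abbrev MatMap (ι κ : Type) : Type := Matrix ι ι ℂ →ₗ[ℂ] Matrix κ κ ℂ

section Maps

variable {ι κ α β α' β' : Type}

/-- `E ⊗ id`: apply `E` to the first tensor factor. -/
def ampLeft (β : Type) (E : MatMap α α') : MatMap (α × β) (α' × β) where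
  toFun X := Matrix.of fun p q => E (Matrix.of fun i j => X (i, p.2) (j, q.2)) p.1 q.1
  map_add' X Y := by
    ext p q
    exact congrFun (congrFun (E.map_add (Matrix.of fun i j => X (i, p.2) (j, q.2))
      (Matrix.of fun i j => Y (i, p.2) (j, q.2))) p.1) q.1
  map_smul' c X := by
    ext p q
    exact congrFun (congrFun (E.map_smul c (Matrix.of fun i j => X (i, p.2) (j, q.2))) p.1) q.1

/-- `id ⊗ F`: apply `F` to the second tensor factor. -/
def ampRight (α : Type) (F : MatMap β β') : MatMap (α × β) (α × β') where
  toFun X := Matrix.of fun p q => F (Matrix.of fun i j => X (p.1, i) (q.1, j)) p.2 q.2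
  map_add' X Y := by
    ext p q
    exact congrFun (congrFun (F.map_add (Matrix.of fun i j => X (p.1, i) (q.1, j))
      (Matrix.of fun i j => Y (p.1, i) (q.1, j))) p.2) q.2
  map_smul' c X := by
    ext p q
    exact congrFun (congrFun (F.map_smul c (Matrix.of fun i j => X (p.1, i) (q.1, j))) p.2) q.2

/-- The tensor product `E ⊗ F` of two maps. -/
def tensorMap (E : MatMap α α') (F : MatMap β β') : MatMap (α × β) (α' × β') :=
  ampLeft β' E ∘ₗ ampRight α F

/-- Complete positivity: `id_n ⊗ Λ` preserves positive semidefiniteness for every `n`. -/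
def IsCP (Λ : MatMap ι κ) : Prop :=
  ∀ (n : ℕ) (X : Matrix (Fin n × ι) (Fin n × ι) ℂ),
    X.PosSemidef → (ampRight (Fin n) Λ X).PosSemidef

/-- Trace preservation. -/
def IsTP [Fintype ι] [Fintype κ] (Λ : MatMap ι κ) : Prop :=
  ∀ X : Matrix ι ι ℂ, (Λ X).trace = X.trace

/-- Quantum channels: completely positive trace-preserving maps. -/
def IsCPTP [Fintype ι] [Fintype κ] (Λ : MatMap ι κ) : Prop :=
  IsCP Λ ∧ IsTP Λ

/-- Quantum instruments with finitely many outcomes: completely positive maps whose sum is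
trace-preserving. -/
def IsInstrument [Fintype ι] [Fintype κ] {k : ℕ} (E : Fin k → MatMap ι κ) : Prop :=
  (∀ i, IsCP (E i)) ∧ IsTP (∑ i, E i)

/-- The partial transpose `X ↦ X^{T_B}`. -/
def partialTranspose (X : Matrix (α × β) (α × β) ℂ) : Matrix (α × β) (α × β) ℂ :=
  Matrix.of fun p q => X (p.1, q.2) (q.1, p.2)

/-- The rank-one operator `|x⟩⟨x|`. -/
def proj (x : ι → ℂ) : Matrix ι ι ℂ := Matrix.vecMulVec x (star x)

/-- The trace norm `‖X‖₁ = Tr |X|`, where `|X| = (Xᴴ X)^{1/2}`. -/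
def traceNorm [Fintype ι] [DecidableEq ι] (X : Matrix ι ι ℂ) : ℝ :=
  (CFC.abs X).trace.re

/-- The Choi matrix `J_Λ = ∑ |i⟩⟨j| ⊗ Λ(|i⟩⟨j|)` of `Λ : AB → A'B'`, with its indices grouped
according to the bipartition `AA' | BB'`. -/
def choi [DecidableEq α] [DecidableEq β] (Λ : MatMap (α × β) (α' × β')) :
    Matrix ((α × α') × (β × β')) ((α × α') × (β × β')) ℂ :=
  Matrix.of fun p q =>
    Λ (Matrix.single (p.1.1, p.2.1) (q.1.1, q.2.1) 1) (p.1.2, p.2.2) (q.1.2, q.2.2)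

end Maps

section Sets

variable (α β : Type) [Fintype α] [Fintype β]

/-- Separable states: the convex hull of the pure product states. -/
def SEP : Set (Matrix (α × β) (α × β) ℂ) :=
  convexHull ℝ {X | ∃ (φ : EuclideanSpace ℂ α) (η : EuclideanSpace ℂ β), ‖φ‖ = 1 ∧ ‖η‖ = 1 ∧
    X = proj fun p : α × β => φ p.1 * η p.2}

/-- States with positive partial transpose. -/
def PPTplus : Set (Matrix (α × β) (α × β) ℂ) :=
  {X | X.trace = 1 ∧ X.PosSemidef ∧ (partialTranspose X).PosSemidef}

/-- The Rains set. -/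
def Rains [DecidableEq α] [DecidableEq β] : Set (Matrix (α × β) (α × β) ℂ) :=
  {X | X.PosSemidef ∧ traceNorm (partialTranspose X) ≤ 1}

end Sets

/-- One-way LOCC: Alice applies an instrument and sends its outcome `i` to Bob, who applies a
channel that may depend on `i`. -/
def IsOneWayLOCC {a b a' b' : ℕ} (Λ : MatMap (Fin a × Fin b) (Fin a' × Fin b')) : Prop :=
  ∃ (k : ℕ) (E : Fin k → MatMap (Fin a) (Fin a')) (F : Fin k → MatMap (Fin b) (Fin b')),
    IsInstrument E ∧ (∀ i, IsCPTP (F i)) ∧ Λ = ∑ i, tensorMap (E i) (F i)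

/-- LOCC: protocols with finitely many rounds. In a round one party applies an instrument to its
own system and announces the outcome, and all that follows may depend on it; at the end both
parties apply local channels. -/
inductive IsLOCC {a' b' : ℕ} :
    {a b : ℕ} → MatMap (Fin a × Fin b) (Fin a' × Fin b') → Prop
  | done {a b : ℕ} (E : MatMap (Fin a) (Fin a')) (F : MatMap (Fin b) (Fin b'))
      (hE : IsCPTP E) (hF : IsCPTP F) : IsLOCC (tensorMap E F)
  | alice {a b c k : ℕ} (E : Fin k → MatMap (Fin a) (Fin c)) (hE : IsInstrument E)
      (Λ : Fin k → MatMap (Fin c × Fin b) (Fin a' × Fin b')) (hΛ : ∀ i, IsLOCC (Λ i)) :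
      IsLOCC (∑ i, Λ i ∘ₗ ampLeft (Fin b) (E i))
  | bob {a b c k : ℕ} (F : Fin k → MatMap (Fin b) (Fin c)) (hF : IsInstrument F)
      (Λ : Fin k → MatMap (Fin a × Fin c) (Fin a' × Fin b')) (hΛ : ∀ i, IsLOCC (Λ i)) :
      IsLOCC (∑ i, Λ i ∘ₗ ampRight (Fin a) (F i))

/-- Names of the six classes of operations. -/
inductive OpClass
  | oneWayLOCC
  | LOCC
  | PPT
  | RainsPreserving
  | PPTplusPreserving
  | SEPP

/-- Membership of `Λ : AB → A'B'` in a class of operations. -/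
def OpClass.Mem {a b a' b' : ℕ} (Λ : MatMap (Fin a × Fin b) (Fin a' × Fin b')) :
    OpClass → Prop
  | .oneWayLOCC => IsOneWayLOCC Λ
  | .LOCC => IsLOCC Λ
  | .PPT => IsCPTP Λ ∧ (partialTranspose (choi Λ)).PosSemidef
  | .RainsPreserving => IsCPTP Λ ∧ ∀ X ∈ Rains (Fin a) (Fin b), Λ X ∈ Rains (Fin a') (Fin b')
  | .PPTplusPreserving =>
      IsCPTP Λ ∧ ∀ X ∈ PPTplus (Fin a) (Fin b), Λ X ∈ PPTplus (Fin a') (Fin b')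
  | .SEPP => IsCPTP Λ ∧ ∀ X ∈ SEP (Fin a) (Fin b), Λ X ∈ SEP (Fin a') (Fin b')

/-- The vector `|Ψ_m⟩ = m^{-1/2} ∑ |ii⟩` of the maximally entangled state. -/
def maxEntVec (m : ℕ) : Fin m × Fin m → ℂ :=
  fun p => if p.1 = p.2 then ((1 / √(m : ℝ) : ℝ) : ℂ) else 0

/-- The fidelity of distillation `F_O(ρ, m) = sup_{Λ ∈ O} ⟨Λ(ρ), Ψ_m⟩`. -/
def fidelity {a b : ℕ} (O : OpClass) (ρ : Matrix (Fin a × Fin b) (Fin a × Fin b) ℂ) (m : ℕ) : ℝ :=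
  sSup {t : ℝ | ∃ Λ : MatMap (Fin a × Fin b) (Fin m × Fin m), O.Mem Λ ∧
    t = (((Λ ρ).conjTranspose * proj (maxEntVec m)).trace).re}

/-- The `m`-distillation norm `min_{x = y + z} ‖y‖_{ℓ₁} + √m ‖z‖_{ℓ₂}`. -/
def distNorm {d : ℕ} (m : ℕ) (x : Fin d → ℂ) : ℝ :=
  sInf {t : ℝ | ∃ y z : Fin d → ℂ, x = y + z ∧
    t = ∑ i, ‖y i‖ + √(m : ℝ) * √(∑ i, ‖z i‖ ^ 2)}

/-- `ξ` is a vector of Schmidt coefficients of `ψ`: `ψ = ∑ ξ_i e_i ⊗ f_i` with `ξ_i ≥ 0` and with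
orthonormal families `e`, `f` of length `min a b`. -/
def IsSchmidtVector {a b : ℕ} (ψ : EuclideanSpace ℂ (Fin a × Fin b)) (ξ : Fin (min a b) → ℝ) :
    Prop :=
  ∃ (e : Fin (min a b) → EuclideanSpace ℂ (Fin a)) (f : Fin (min a b) → EuclideanSpace ℂ (Fin b)),
    Orthonormal ℂ e ∧ Orthonormal ℂ f ∧ (∀ i, 0 ≤ ξ i) ∧
      ∀ p, ψ p = ∑ i, (ξ i : ℂ) * (e i p.1 * f i p.2)

open Matrix in
theorem exists_schmidt_aux {a b : ℕ} (hab : a ≤ b) (M : Matrix (Fin a) (Fin b) ℂ) :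
    ∃ (ξ : Fin a → ℝ) (e : Fin a → EuclideanSpace ℂ (Fin a))
      (f : Fin a → EuclideanSpace ℂ (Fin b)),
      Orthonormal ℂ e ∧ Orthonormal ℂ f ∧ (∀ i, 0 ≤ ξ i) ∧
        ∀ p q, M p q = ∑ i, (ξ i : ℂ) * (e i p * f i q) := by
  classical
  have hps := Matrix.posSemidef_self_mul_conjTranspose M
  set hH := hps.isHermitian
  set e := hH.eigenvectorBasis with he
  set v : Fin a → EuclideanSpace ℂ (Fin b) :=
    fun i => WithLp.toLp 2 fun q => ∑ p, star (e i p) * M p q with hv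
  have hinner : ∀ i j, inner ℂ (v i) (v j) = if i = j then (hH.eigenvalues i : ℂ) else 0 := by
    intro i j
    have h1 : inner ℂ (v i) (v j) = inner ℂ (e j) (WithLp.toLp 2 ((M * Mᴴ) *ᵥ (e i).ofLp)) := by
      simp only [hv, PiLp.inner_apply, RCLike.inner_apply, map_sum, Matrix.mulVec, dotProduct,
        Matrix.mul_apply, conjTranspose_apply, Finset.sum_mul, Finset.mul_sum, map_mul,
        RCLike.star_def, RCLike.conj_conj]
      rw [Finset.sum_congr rfl fun q _ => Finset.sum_comm, Finset.sum_comm]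
      refine Finset.sum_congr rfl fun x _ => ?_
      rw [Finset.sum_comm]
      refine Finset.sum_congr rfl fun y _ => Finset.sum_congr rfl fun z _ => ?_
      ring
    rw [h1, hH.mulVec_eigenvectorBasis]
    have h2 : (WithLp.toLp 2 (hH.eigenvalues i • (e i).ofLp) : EuclideanSpace ℂ (Fin a)) =
        (hH.eigenvalues i : ℂ) • e i := by
      ext p; simp [Complex.real_smul]
    rw [h2, inner_smul_right, orthonormal_iff_ite.mp e.orthonormal]
    by_cases h : i = j
    · subst h; simp
    · simp [h, Ne.symm h]
  set s : Fin a → ℝ := fun i => √(hH.eigenvalues i) with hs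
  have hss : ∀ i, s i * s i = hH.eigenvalues i := fun i =>
    Real.mul_self_sqrt (hps.eigenvalues_nonneg i)
  -- normalised vectors, as a family on the larger index set
  set g : Fin b → EuclideanSpace ℂ (Fin b) := fun j =>
    if h : (j : ℕ) < a then ((s ⟨j, h⟩ : ℂ)⁻¹) • v ⟨j, h⟩ else 0 with hg
  set S : Set (Fin b) := {j | ∃ h : (j : ℕ) < a, s ⟨j, h⟩ ≠ 0} with hS
  have hortho : Orthonormal ℂ (S.domRestrict g) := by
    rw [orthonormal_iff_ite]
    rintro ⟨j, hj, hj0⟩ ⟨k, hk, hk0⟩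
    simp only [Set.domRestrict_apply, hg, hj, hk, dite_true, inner_smul_left, inner_smul_right,
      hinner, Subtype.mk.injEq, Fin.mk.injEq]
    by_cases h : (j : ℕ) = k
    · have h' : j = k := Fin.ext h
      subst h'
      have : (s ⟨j, hj⟩ : ℂ) ≠ 0 := by exact_mod_cast hj0
      simp only [if_true, ← hss, map_inv₀, Complex.conj_ofReal]
      push_cast
      field_simp
    · have h' : j ≠ k := fun hh => h (congrArg _ hh)
      simp [h, h']
  obtain ⟨B, hB⟩ := hortho.exists_orthonormalBasis_extension_of_card_eq (by simp)
  refine ⟨s, e, fun i => B (Fin.castLE hab i), e.orthonormal,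
    B.orthonormal.comp _ (Fin.castLE_injective hab), fun i => Real.sqrt_nonneg _, ?_⟩
  have hsv : ∀ i, (s i : ℂ) • B (Fin.castLE hab i) = v i := by
    intro i
    by_cases h : s i = 0
    · have : v i = 0 := by
        rw [← inner_self_eq_zero (𝕜 := ℂ), hinner]
        simp [← hss, h]
      simp [h, this]
    · have hmem : Fin.castLE hab i ∈ S := ⟨i.2, h⟩
      have h0 : (s i : ℂ) ≠ 0 := by exact_mod_cast h
      rw [hB _ hmem]
      simp [hg, smul_smul, h0]
  intro p q
  have h1 : ∀ i, (s i : ℂ) * (e i p * B (Fin.castLE hab i) q) = e i p * v i q := by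
    intro i
    rw [← hsv i]
    simp only [PiLp.smul_apply, smul_eq_mul]
    ring
  rw [Finset.sum_congr rfl fun i _ => h1 i]
  have h2 := congrArg (fun x : EuclideanSpace ℂ (Fin a) => x p)
    (e.sum_repr (WithLp.toLp 2 fun r => M r q))
  simp only [WithLp.ofLp_sum, Finset.sum_apply, PiLp.smul_apply, smul_eq_mul] at h2
  rw [← h2]
  refine Finset.sum_congr rfl fun i _ => ?_
  rw [mul_comm, e.repr_apply_apply]
  congr 1
  simp only [hv, PiLp.inner_apply, RCLike.inner_apply, RCLike.star_def]
  exact Finset.sum_congr rfl fun r _ => mul_comm _ _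

/-- Every vector has a Schmidt decomposition. -/
theorem exists_isSchmidtVector {a b : ℕ} (ψ : EuclideanSpace ℂ (Fin a × Fin b)) :
    ∃ ξ, IsSchmidtVector ψ ξ := by
  rcases le_total a b with h | h
  · obtain ⟨ξ, e, f, he, hf, h0, hM⟩ := exists_schmidt_aux h (Matrix.of fun p q => ψ (p, q))
    unfold IsSchmidtVector
    rw [min_eq_left h]
    exact ⟨ξ, e, f, he, hf, h0, fun p => hM p.1 p.2⟩
  · obtain ⟨ξ, e, f, he, hf, h0, hM⟩ := exists_schmidt_aux h (Matrix.of fun p q => ψ (q, p))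
    unfold IsSchmidtVector
    rw [min_eq_right h]
    refine ⟨ξ, f, e, hf, he, h0, fun p => (hM p.2 p.1).trans ?_⟩
    exact Finset.sum_congr rfl fun i _ => by ring

end Distillation

end

/-!
Write `x` for the Schmidt vector of `ψ`.

*Upper bound.* All six classes consist of positive trace-preserving maps that send pure product
states into the Rains set, and only this property is used. The overlap of such a `Λ` with `Ψ_m`
is a positive functional, so `⟨Λ(|u⟩⟨u|), Ψ_m⟩ = ‖T u‖ ^ 2` for some linear operator `T`. Since `Λ`
preserves the trace, `‖T u‖ ≤ ‖u‖`. On product vectors this improves to `‖T u‖ ≤ ‖u‖ / √m`, because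
`Ψ_m ^ {T_B}` is the swap divided by `m`, whose pairing with `X ^ {T_B}` is at most
`‖X ^ {T_B}‖₁ / m`. Splitting `x = y + z` and applying the product bound to the terms of `y` and the
norm bound to `z` gives `√m ‖T ψ‖ ≤ ‖y‖₁ + √m ‖z‖₂`.

*Lower bound.* Cutting `x` off at a suitable level `t` provides a dual vector `w` with `0 ≤ w ≤ 1`,
`‖w‖₂ ^ 2 ≤ m` and `‖x‖_[m] ≤ ⟨w, x⟩`. The vector `(w i ^ 2)` lies in the hypersimplex, so
Birkhoff's theorem, applied to a doubly stochastic matrix having it as the row sums of its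
off-diagonal block, writes it as a convex combination with weights `l s` of indicators of the
domains of partial matchings `g s` of the Schmidt indices with the `m` levels. Alice measures with
the Kraus operators `∑ √(l s) / w i |g s i⟩⟨e i|` and announces `s`, and Bob applies
`∑ |g s i⟩⟨f i|`. Outcome `s` contributes `l s / m * (∑ x i / w i) ^ 2`, summed over the domain of
`g s`, and by Jensen's inequality these contributions add up to at least `⟨w, x⟩ ^ 2 / m`.
-/

namespace Distillation

open Matrix
open scoped Finset Kronecker

section Amplification

variable {ι κ μ α β α' β' : Type}

theorem ampLeft_kronecker (E : MatMap α α') (A : Matrix α α ℂ) (B : Matrix β β ℂ) :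
    ampLeft β E (A ⊗ₖ B) = E A ⊗ₖ B := by
  ext p q
  have h : (of fun i j => (A ⊗ₖ B) (i, p.2) (j, q.2)) = B p.2 q.2 • A := by
    ext i j
    simp [mul_comm]
  change E (of fun i j => (A ⊗ₖ B) (i, p.2) (j, q.2)) p.1 q.1 = _
  rw [h, map_smul]
  simp [kroneckerMap_apply, mul_comm]

theorem ampRight_kronecker (F : MatMap β β') (A : Matrix α α ℂ) (B : Matrix β β ℂ) :
    ampRight α F (A ⊗ₖ B) = A ⊗ₖ F B := by
  ext p q
  have h : (of fun i j => (A ⊗ₖ B) (p.1, i) (q.1, j)) = A p.1 q.1 • B := by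
    ext i j
    simp
  change F (of fun i j => (A ⊗ₖ B) (p.1, i) (q.1, j)) p.2 q.2 = _
  rw [h, map_smul]
  simp [kroneckerMap_apply]

theorem tensorMap_kronecker (E : MatMap α α') (F : MatMap β β') (A : Matrix α α ℂ)
    (B : Matrix β β ℂ) : tensorMap E F (A ⊗ₖ B) = E A ⊗ₖ F B := by
  rw [tensorMap, LinearMap.comp_apply, ampRight_kronecker, ampLeft_kronecker]

theorem linearMap_ext_kronecker [Finite α] [Finite β] {M : Type*} [AddCommMonoid M] [Module ℂ M]
    {f g : Matrix (α × β) (α × β) ℂ →ₗ[ℂ] M} (h : ∀ A B, f (A ⊗ₖ B) = g (A ⊗ₖ B)) : f = g := by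
  classical
  have := Fintype.ofFinite α
  have := Fintype.ofFinite β
  refine Matrix.ext_linearMap _ fun p q => LinearMap.ext fun c => ?_
  have hs : (single p q c : Matrix (α × β) (α × β) ℂ) = single p.1 q.1 c ⊗ₖ single p.2 q.2 1 := by
    rw [single_kronecker_single, mul_one]
  change f (single p q c) = g (single p q c)
  rw [hs, h]

theorem tensorMap_eq_ampRight_comp_ampLeft [Finite α] [Finite β] (E : MatMap α α')
    (F : MatMap β β') : tensorMap E F = ampRight α' F ∘ₗ ampLeft β E :=
  linearMap_ext_kronecker fun A B => by
    rw [tensorMap_kronecker, LinearMap.comp_apply, ampLeft_kronecker, ampRight_kronecker]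

theorem ampLeft_sum {σ : Type*} (s : Finset σ) (E : σ → MatMap α α') :
    ampLeft β (∑ i ∈ s, E i) = ∑ i ∈ s, ampLeft β (E i) := by
  ext1 X
  ext p q
  simp [ampLeft, LinearMap.sum_apply, Matrix.sum_apply]

theorem ampRight_sum {σ : Type*} (s : Finset σ) (F : σ → MatMap β β') :
    ampRight α (∑ i ∈ s, F i) = ∑ i ∈ s, ampRight α (F i) := by
  ext1 X
  ext p q
  simp [ampRight, LinearMap.sum_apply, Matrix.sum_apply]

theorem IsCP.posSemidef_ampRight {F : MatMap β β'} (hF : IsCP F) [Finite α]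
    {X : Matrix (α × β) (α × β) ℂ} (hX : X.PosSemidef) : (ampRight α F X).PosSemidef := by
  obtain ⟨n, ⟨e⟩⟩ := Finite.exists_equiv_fin α
  have h := (hF n _ (hX.submatrix (Prod.map e.symm id))).submatrix (Prod.map e id)
  convert h using 1
  ext p q
  simp [ampRight]

theorem IsCP.posSemidef {Λ : MatMap ι κ} (hΛ : IsCP Λ) {X : Matrix ι ι ℂ} (hX : X.PosSemidef) :
    (Λ X).PosSemidef :=
  (hΛ 1 _ (hX.submatrix Prod.snd)).submatrix fun i => ((0 : Fin 1), i)

theorem IsCP.comp {Λ : MatMap κ μ} {E : MatMap ι κ} (hΛ : IsCP Λ) (hE : IsCP E) :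
    IsCP (Λ ∘ₗ E) :=
  fun n _ hX => hΛ n _ (hE n _ hX)

theorem isCP_sum {σ : Type*} {s : Finset σ} {E : σ → MatMap ι κ} (hE : ∀ i ∈ s, IsCP (E i)) :
    IsCP (∑ i ∈ s, E i) := by
  intro n X hX
  rw [ampRight_sum, LinearMap.sum_apply]
  exact posSemidef_sum _ fun i hi => hE i hi n X hX

theorem IsCP.ampRight [Finite α] {F : MatMap β β'} (hF : IsCP F) : IsCP (ampRight α F) :=
  fun n _ hX => (hF.posSemidef_ampRight (hX.submatrix (Equiv.prodAssoc (Fin n) α β))).submatrix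
    (Equiv.prodAssoc (Fin n) α β').symm

theorem IsCP.ampLeft [Finite β] {E : MatMap α α'} (hE : IsCP E) : IsCP (ampLeft β E) :=
  fun n _ hX => (hE.posSemidef_ampRight (α := Fin n × β)
    (hX.submatrix fun p : (Fin n × β) × α => (p.1.1, (p.2, p.1.2)))).submatrix
    fun p : Fin n × (α' × β) => ((p.1, p.2.2), p.2.1)

theorem IsCP.tensorMap [Finite α] [Finite β'] {E : MatMap α α'} {F : MatMap β β'} (hE : IsCP E)
    (hF : IsCP F) : IsCP (tensorMap E F) :=
  hE.ampLeft.comp hF.ampRight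

variable [Fintype ι] [Fintype κ] [Fintype μ] [Fintype α] [Fintype β] [Fintype α'] [Fintype β']

theorem IsTP.comp {Λ : MatMap κ μ} {E : MatMap ι κ} (hΛ : IsTP Λ) (hE : IsTP E) :
    IsTP (Λ ∘ₗ E) :=
  fun X => (hΛ (E X)).trans (hE X)

theorem IsTP.ampRight {F : MatMap β β'} (hF : IsTP F) : IsTP (ampRight α F) := fun X => by
  simp only [trace, diag_apply, Fintype.sum_prod_type]
  exact Finset.sum_congr rfl fun i _ => hF (of fun j k => X (i, j) (i, k))

theorem IsTP.ampLeft {E : MatMap α α'} (hE : IsTP E) : IsTP (ampLeft β E) := fun X => by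
  simp only [trace, diag_apply, Fintype.sum_prod_type_right]
  exact Finset.sum_congr rfl fun i _ => hE (of fun j k => X (j, i) (k, i))

theorem IsTP.tensorMap {E : MatMap α α'} {F : MatMap β β'} (hE : IsTP E) (hF : IsTP F) :
    IsTP (tensorMap E F) :=
  hE.ampLeft.comp hF.ampRight

theorem IsTP.sum_comp {σ : Type*} {s : Finset σ} {Λ : σ → MatMap κ μ} {E : σ → MatMap ι κ}
    (hΛ : ∀ i ∈ s, IsTP (Λ i)) (hE : IsTP (∑ i ∈ s, E i)) : IsTP (∑ i ∈ s, Λ i ∘ₗ E i) :=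
  fun X => by
    simp only [LinearMap.sum_apply, trace_sum, LinearMap.comp_apply]
    rw [Finset.sum_congr rfl fun i hi => hΛ i hi (E i X), ← trace_sum, ← LinearMap.sum_apply, hE]

theorem isCPTP_id : IsCPTP (LinearMap.id : MatMap ι ι) :=
  ⟨fun _ _ hX => hX, fun _ => rfl⟩

end Amplification

section Positivity

variable {ι κ : Type}

/-- Positivity of a linear map between matrix spaces: it preserves positive semidefiniteness. -/
def IsPositiveMap (Λ : MatMap ι κ) : Prop :=
  ∀ X : Matrix ι ι ℂ, X.PosSemidef → (Λ X).PosSemidef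

theorem IsCP.isPositiveMap {Λ : MatMap ι κ} (hΛ : IsCP Λ) : IsPositiveMap Λ :=
  fun _ hX => hΛ.posSemidef hX

theorem posSemidef_proj [Finite ι] (x : ι → ℂ) : (proj x).PosSemidef :=
  posSemidef_vecMulVec_self_star x

theorem trace_proj [Fintype ι] (x : EuclideanSpace ℂ ι) : (proj x).trace = (‖x‖ : ℂ) ^ 2 := by
  rw [← Complex.ofReal_pow, EuclideanSpace.norm_sq_eq, proj, trace_vecMulVec]
  simp [dotProduct, Complex.mul_conj']

theorem proj_smul (c : ℂ) (x : ι → ℂ) : proj (c • x) = (‖c‖ ^ 2 : ℝ) • proj x := by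
  ext p q
  simp only [proj, vecMulVec_apply, Pi.smul_apply, Pi.star_apply, smul_eq_mul, star_mul',
    Matrix.smul_apply, Complex.real_smul, Complex.ofReal_pow, ← Complex.mul_conj', RCLike.star_def]
  ring

theorem exists_proj_eq_smul_proj [Fintype ι] {x : ι → ℂ} (hx : x ≠ 0) :
    ∃ u : EuclideanSpace ℂ ι, ‖u‖ = 1 ∧ ∃ c : ℝ, 0 ≤ c ∧ proj x = c • proj u := by
  set v : EuclideanSpace ℂ ι := WithLp.toLp 2 x
  have hv : (‖v‖ : ℂ) ≠ 0 := by simpa [v] using hx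
  refine ⟨(‖v‖⁻¹ : ℂ) • v, norm_smul_inv_norm (by simpa using hv), ‖(‖v‖ : ℂ)‖ ^ 2,
    by positivity, ?_⟩
  rw [← proj_smul, WithLp.ofLp_smul, smul_inv_smul₀ hv]

theorem exists_eq_sum_proj [Fintype ι] {X : Matrix ι ι ℂ} (hX : X.PosSemidef) :
    ∃ v : ι → ι → ℂ, X = ∑ k, proj (v k) := by
  classical
  obtain ⟨C, rfl⟩ := CStarAlgebra.nonneg_iff_eq_star_mul_self.mp hX.nonneg
  refine ⟨fun k => star (C k), ?_⟩
  ext p q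
  simp [Matrix.mul_apply, Matrix.sum_apply, proj, vecMulVec_apply]

theorem isPositiveMap_of_forall_proj [Finite ι] {Λ : MatMap ι κ}
    (h : ∀ v : ι → ℂ, (Λ (proj v)).PosSemidef) : IsPositiveMap Λ := by
  have := Fintype.ofFinite ι
  intro X hX
  obtain ⟨v, rfl⟩ := exists_eq_sum_proj hX
  rw [map_sum]
  exact posSemidef_sum _ fun k _ => h (v k)

theorem proj_eq_sum_single [Fintype ι] [DecidableEq ι] (v : ι → ℂ) :
    proj v = ∑ i, ∑ j, (v i * star (v j)) • single i j (1 : ℂ) := by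
  conv_lhs => rw [matrix_eq_sum_single (proj v)]
  simp [proj, vecMulVec_apply]

end Positivity

section Choi

variable {ι κ α β α' β' : Type}

/-- The Choi matrix of a map between arbitrary systems; for bipartite systems it agrees with
`choi` up to the grouping of the indices. -/
def ungroupedChoi [DecidableEq ι] (Λ : MatMap ι κ) : Matrix (ι × κ) (ι × κ) ℂ :=
  of fun p q => Λ (single p.1 q.1 1) p.2 q.2

theorem choi_submatrix_prodProdProdComm [DecidableEq α] [DecidableEq β]
    (Λ : MatMap (α × β) (α' × β')) :
    (choi Λ).submatrix (Equiv.prodProdProdComm α β α' β') (Equiv.prodProdProdComm α β α' β') =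
      ungroupedChoi Λ := rfl

theorem posSemidef_choi_iff [DecidableEq α] [DecidableEq β] (Λ : MatMap (α × β) (α' × β')) :
    (choi Λ).PosSemidef ↔ (ungroupedChoi Λ).PosSemidef := by
  rw [← choi_submatrix_prodProdProdComm, posSemidef_submatrix_equiv]

theorem IsCP.posSemidef_ungroupedChoi [Finite ι] [DecidableEq ι] {Λ : MatMap ι κ} (hΛ : IsCP Λ) :
    (ungroupedChoi Λ).PosSemidef := by
  convert hΛ.posSemidef_ampRight
    (posSemidef_proj fun r : ι × ι => if r.1 = r.2 then (1 : ℂ) else 0) using 1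
  ext p q
  refine congrFun (congrFun (congrArg Λ (Matrix.ext fun k l => ?_)) p.2) q.2
  simp [proj, vecMulVec_apply, single_apply, ← ite_and, and_comm]

theorem isPositiveMap_of_posSemidef_ungroupedChoi [Finite ι] [DecidableEq ι] [Finite κ]
    {Λ : MatMap ι κ} (h : (ungroupedChoi Λ).PosSemidef) : IsPositiveMap Λ := by
  classical
  have := Fintype.ofFinite ι
  have := Fintype.ofFinite κ
  refine isPositiveMap_of_forall_proj fun v => ?_
  convert h.mul_mul_conjTranspose_same
    (of fun (p : κ) (r : ι × κ) => if r.2 = p then v r.1 else 0) using 1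
  ext p q
  rw [proj_eq_sum_single]
  simp only [map_sum, map_smul, Matrix.sum_apply, Matrix.smul_apply, smul_eq_mul, mul_apply,
    Fintype.sum_prod_type, of_apply, ungroupedChoi, conjTranspose_apply, apply_ite star, star_zero,
    ite_mul, mul_ite, zero_mul, mul_zero, Finset.sum_ite_eq', Finset.mem_univ, if_true,
    Finset.sum_mul]
  rw [Finset.sum_comm]
  exact Finset.sum_congr rfl fun _ _ => Finset.sum_congr rfl fun _ _ => by ring

end Choi

section PartialTranspose

variable {α β γ α' β' : Type}

/-- The partial transpose as a linear map. -/
def partialTransposeₗ : MatMap (α × β) (α × β) where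
  toFun := partialTranspose
  map_add' _ _ := rfl
  map_smul' _ _ := rfl

/-- The conjugate `X ↦ F(Xᵀ)ᵀ` of a map by the transposes. Partial transposition turns a local map
`F` of the second party into this map. -/
def transposeConj (F : MatMap α β) : MatMap α β :=
  (transposeLinearEquiv β β ℂ ℂ).toLinearMap ∘ₗ F ∘ₗ (transposeLinearEquiv α α ℂ ℂ).toLinearMap

/-- The conjugate `X ↦ (Λ(X^{T_B}))^{T_{B'}}` of a map by the partial transposes. Its complete
positivity is the condition `J_Λ^{T_{BB'}} ⪰ 0` defining the PPT operations. -/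
def partialTransposeConj (Λ : MatMap (α × β) (α' × β')) : MatMap (α × β) (α' × β') :=
  partialTransposeₗ ∘ₗ Λ ∘ₗ partialTransposeₗ

theorem IsCP.transposeConj {F : MatMap α β} (hF : IsCP F) : IsCP (transposeConj F) :=
  fun n _ hX => (hF n _ hX.transpose).transpose

theorem partialTransposeConj_tensorMap (E : MatMap α α') (F : MatMap β β') :
    partialTransposeConj (tensorMap E F) = tensorMap E (transposeConj F) := rfl

theorem partialTransposeConj_comp_ampLeft (Λ : MatMap (γ × β) (α' × β')) (E : MatMap α γ) :
    partialTransposeConj (Λ ∘ₗ ampLeft β E) = partialTransposeConj Λ ∘ₗ ampLeft β E := rfl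

theorem partialTransposeConj_comp_ampRight (Λ : MatMap (α × γ) (α' × β')) (F : MatMap β γ) :
    partialTransposeConj (Λ ∘ₗ ampRight α F) =
      partialTransposeConj Λ ∘ₗ ampRight α (transposeConj F) := rfl

theorem partialTransposeConj_sum {σ : Type*} (s : Finset σ)
    (Λ : σ → MatMap (α × β) (α' × β')) :
    partialTransposeConj (∑ i ∈ s, Λ i) = ∑ i ∈ s, partialTransposeConj (Λ i) := by
  ext1 X
  simp only [partialTransposeConj, LinearMap.comp_apply, LinearMap.sum_apply, map_sum]

theorem partialTranspose_single [DecidableEq α] [DecidableEq β] (p q : α × β) :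
    partialTranspose (single p q (1 : ℂ)) = single (p.1, q.2) (q.1, p.2) 1 := by
  ext r s
  simp only [partialTranspose, of_apply, single_apply, Prod.ext_iff]
  congr 1
  simp only [eq_iff_iff]
  tauto

theorem choi_partialTransposeConj [DecidableEq α] [DecidableEq β]
    (Λ : MatMap (α × β) (α' × β')) :
    choi (partialTransposeConj Λ) = partialTranspose (choi Λ) := by
  ext p q
  change Λ (partialTranspose (single _ _ 1)) _ _ = _
  rw [partialTranspose_single]
  rfl

theorem isHermitian_partialTranspose {X : Matrix (α × β) (α × β) ℂ} (hX : X.IsHermitian) :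
    (partialTranspose X).IsHermitian :=
  Matrix.ext fun p q => hX.apply (p.1, q.2) (q.1, p.2)

variable [Fintype α] [Fintype β] [Fintype α'] [Fintype β']

theorem trace_partialTranspose (X : Matrix (α × β) (α × β) ℂ) :
    (partialTranspose X).trace = X.trace := rfl

theorem IsTP.partialTransposeConj {Λ : MatMap (α × β) (α' × β')} (hΛ : IsTP Λ) :
    IsTP (partialTransposeConj Λ) :=
  fun X => hΛ (partialTranspose X)

end PartialTranspose

section TraceNorm

variable {ι κ : Type} [Fintype ι] [Fintype κ]

theorem trace_mul_nonneg {A B : Matrix ι ι ℂ} (hA : A.PosSemidef) (hB : B.PosSemidef) :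
    0 ≤ (A * B).trace := by
  classical
  obtain ⟨C, rfl⟩ := CStarAlgebra.nonneg_iff_eq_star_mul_self.mp hB.nonneg
  rw [star_eq_conjTranspose, ← Matrix.mul_assoc, trace_mul_comm, ← Matrix.mul_assoc]
  exact (hA.mul_mul_conjTranspose_same C).trace_nonneg

theorem re_trace_mul_le_of_le {S T P : Matrix ι ι ℂ} (hST : S ≤ T) (hP : P.PosSemidef) :
    (S * P).trace.re ≤ (T * P).trace.re := by
  have h := (Complex.le_def.mp (trace_mul_nonneg (le_iff.mp hST) hP)).1
  rwa [Matrix.sub_mul, trace_sub, Complex.sub_re, Complex.zero_re, sub_nonneg] at h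

variable [DecidableEq ι] [DecidableEq κ]

theorem traceNorm_of_posSemidef {X : Matrix ι ι ℂ} (hX : X.PosSemidef) :
    traceNorm X = X.trace.re := by
  rw [traceNorm, CFC.abs_of_nonneg X hX.nonneg]

theorem traceNorm_eq_trace_posPart_add_trace_negPart {Y : Matrix ι ι ℂ} (hY : Y.IsHermitian) :
    traceNorm Y = (Y⁺).trace.re + (Y⁻).trace.re := by
  rw [traceNorm, ← CFC.posPart_add_negPart Y hY.isSelfAdjoint, trace_add, Complex.add_re]

theorem re_trace_mul_sub_le {S P N : Matrix ι ι ℂ} (hS : -1 ≤ S) (hS' : S ≤ 1)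
    (hP : P.PosSemidef) (hN : N.PosSemidef) :
    (S * (P - N)).trace.re ≤ P.trace.re + N.trace.re := by
  have h₁ := re_trace_mul_le_of_le hS' hP
  have h₂ := re_trace_mul_le_of_le hS hN
  simp only [Matrix.one_mul, Matrix.neg_mul, trace_neg, Complex.neg_re] at h₁ h₂
  rw [Matrix.mul_sub, trace_sub, Complex.sub_re]
  linarith

theorem re_trace_mul_le_traceNorm {S Y : Matrix ι ι ℂ} (hS : -1 ≤ S) (hS' : S ≤ 1)
    (hY : Y.IsHermitian) : (S * Y).trace.re ≤ traceNorm Y := by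
  rw [traceNorm_eq_trace_posPart_add_trace_negPart hY]
  conv_lhs => rw [← CFC.posPart_sub_negPart Y hY.isSelfAdjoint]
  exact re_trace_mul_sub_le hS hS' (CFC.posPart_nonneg Y).posSemidef
    (CFC.negPart_nonneg Y).posSemidef

theorem exists_traceNorm_eq_re_trace_mul {Y : Matrix ι ι ℂ} (hY : Y.IsHermitian) :
    ∃ S : Matrix ι ι ℂ, -1 ≤ S ∧ S ≤ 1 ∧ traceNorm Y = (S * Y).trace.re := by
  have hcont : ∀ f : ℝ → ℝ, ContinuousOn f (spectrum ℝ Y) :=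
    fun f => Matrix.finite_real_spectrum.continuousOn f
  refine ⟨cfc (fun x : ℝ => (SignType.sign x : ℝ)) Y, ?_, ?_, ?_⟩
  · rw [← map_one (algebraMap ℝ (Matrix ι ι ℂ)), ← map_neg]
    refine algebraMap_le_cfc _ _ _ (fun x _ => ?_) (hcont _) hY.isSelfAdjoint
    rcases lt_trichotomy x 0 with h | h | h <;> simp [h]
  · refine cfc_le_one _ _ fun x _ => ?_
    rcases lt_trichotomy x 0 with h | h | h <;> simp [h]
  · have h : cfc (fun x : ℝ => (SignType.sign x : ℝ)) Y * Y = CFC.abs Y := by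
      rw [CFC.abs_eq_cfc_norm Y hY.isSelfAdjoint]
      nth_rw 2 [← cfc_id' ℝ Y hY.isSelfAdjoint]
      rw [← cfc_mul _ _ Y (hcont _) (hcont _)]
      simp only [sign_mul_self, Real.norm_eq_abs]
    rw [h, traceNorm]

theorem traceNorm_sub_le {P N : Matrix ι ι ℂ} (hP : P.PosSemidef) (hN : N.PosSemidef) :
    traceNorm (P - N) ≤ P.trace.re + N.trace.re := by
  obtain ⟨S, hS, hS', h⟩ := exists_traceNorm_eq_re_trace_mul (hP.isHermitian.sub hN.isHermitian)
  exact h.trans_le (re_trace_mul_sub_le hS hS' hP hN)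

theorem IsPositiveMap.traceNorm_apply_le {Λ : MatMap ι κ} (hΛ : IsPositiveMap Λ) (hΛ' : IsTP Λ)
    {Y : Matrix ι ι ℂ} (hY : Y.IsHermitian) : traceNorm (Λ Y) ≤ traceNorm Y := by
  rw [traceNorm_eq_trace_posPart_add_trace_negPart hY, ← hΛ' Y⁺, ← hΛ' Y⁻]
  conv_lhs => rw [← CFC.posPart_sub_negPart Y hY.isSelfAdjoint, map_sub]
  exact traceNorm_sub_le (hΛ _ (CFC.posPart_nonneg Y).posSemidef)
    (hΛ _ (CFC.negPart_nonneg Y).posSemidef)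

end TraceNorm

section Separable

variable {α β α' β' : Type}

theorem proj_mul_eq_kronecker (φ : α → ℂ) (η : β → ℂ) :
    proj (fun p : α × β => φ p.1 * η p.2) = proj φ ⊗ₖ proj η := by
  ext p q
  simp only [proj, vecMulVec_apply, kroneckerMap_apply, Pi.star_apply, star_mul']
  ring

variable [Fintype α] [Fintype β] [Fintype α'] [Fintype β']

theorem trace_proj_mul {φ : EuclideanSpace ℂ α} {η : EuclideanSpace ℂ β} (hφ : ‖φ‖ = 1)
    (hη : ‖η‖ = 1) : (proj fun p : α × β => φ p.1 * η p.2).trace = 1 := by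
  rw [proj_mul_eq_kronecker, trace_kronecker, trace_proj, trace_proj, hφ, hη]
  simp

theorem proj_mul_mem_SEP {φ : EuclideanSpace ℂ α} {η : EuclideanSpace ℂ β} (hφ : ‖φ‖ = 1)
    (hη : ‖η‖ = 1) : (proj fun p : α × β => φ p.1 * η p.2) ∈ SEP α β :=
  subset_convexHull ℝ _ ⟨φ, η, hφ, hη, rfl⟩

theorem convex_PPTplus : Convex ℝ (PPTplus α β) := by
  rintro X ⟨hX₁, hX₂, hX₃⟩ Y ⟨hY₁, hY₂, hY₃⟩ s t hs ht hst
  refine ⟨?_, (hX₂.smul hs).add (hY₂.smul ht), (hX₃.smul hs).add (hY₃.smul ht)⟩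
  rw [trace_add, trace_smul, trace_smul, hX₁, hY₁, ← add_smul, hst, one_smul]

theorem SEP_subset_PPTplus : SEP α β ⊆ PPTplus α β := by
  refine convexHull_min ?_ convex_PPTplus
  rintro X ⟨φ, η, hφ, hη, rfl⟩
  refine ⟨trace_proj_mul hφ hη, posSemidef_proj _, ?_⟩
  rw [proj_mul_eq_kronecker]
  exact (posSemidef_proj _).kronecker (posSemidef_proj _).transpose

theorem PPTplus_subset_Rains [DecidableEq α] [DecidableEq β] : PPTplus α β ⊆ Rains α β := by
  rintro X ⟨htr, hX, hXΓ⟩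
  refine ⟨hX, ?_⟩
  rw [traceNorm_of_posSemidef hXΓ, trace_partialTranspose, htr, Complex.one_re]

variable (α β) in
/-- The cone of unnormalised separable states. -/
noncomputable def sepCone : PointedCone ℝ (Matrix (α × β) (α × β) ℂ) :=
  PointedCone.hull ℝ (SEP α β)

theorem proj_mul_mem_sepCone (φ : α → ℂ) (η : β → ℂ) :
    proj (fun p : α × β => φ p.1 * η p.2) ∈ sepCone α β := by
  rw [proj_mul_eq_kronecker]
  rcases eq_or_ne φ 0 with rfl | hφ
  · simp [proj]
  rcases eq_or_ne η 0 with rfl | hη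
  · simp [proj]
  obtain ⟨u, hu, c, hc, hφu⟩ := exists_proj_eq_smul_proj hφ
  obtain ⟨w, hw, d, hd, hηw⟩ := exists_proj_eq_smul_proj hη
  rw [hφu, hηw, smul_kronecker, kronecker_smul, ← proj_mul_eq_kronecker, smul_smul]
  exact PointedCone.smul_mem _ (mul_nonneg hc hd)
    (PointedCone.subset_hull (proj_mul_mem_SEP hu hw))

theorem kronecker_mem_sepCone {A : Matrix α α ℂ} {B : Matrix β β ℂ} (hA : A.PosSemidef)
    (hB : B.PosSemidef) : A ⊗ₖ B ∈ sepCone α β := by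
  obtain ⟨v, rfl⟩ := exists_eq_sum_proj hA
  obtain ⟨w, rfl⟩ := exists_eq_sum_proj hB
  have h : (∑ k, proj (v k)) ⊗ₖ (∑ l, proj (w l)) = ∑ k, ∑ l, proj (v k) ⊗ₖ proj (w l) := by
    ext p q
    simp [Matrix.sum_apply, Finset.sum_mul_sum]
  rw [h]
  refine sum_mem fun k _ => sum_mem fun l _ => ?_
  rw [← proj_mul_eq_kronecker]
  exact proj_mul_mem_sepCone _ _

theorem mem_SEP_of_mem_sepCone {X : Matrix (α × β) (α × β) ℂ} (hX : X ∈ sepCone α β)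
    (htr : X.trace = 1) : X ∈ SEP α β := by
  obtain ⟨n, c, S, rfl⟩ := Submodule.mem_span_set'.mp hX
  have hc : ∑ i, (c i : ℝ) = 1 := by
    have h : ∀ i, (c i • (S i : Matrix (α × β) (α × β) ℂ)).trace = ((c i : ℝ) : ℂ) := fun i => by
      rw [trace_smul, (SEP_subset_PPTplus (S i).2).1]
      exact (Complex.real_smul).trans (mul_one _)
    rw [trace_sum, Finset.sum_congr rfl fun i _ => h i] at htr
    exact_mod_cast htr
  exact (convex_convexHull ℝ _).sum_mem (fun i _ => (c i).2) hc fun i _ => (S i).2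

end Separable

section Hierarchy

variable {a b a' b' : ℕ} {Λ : MatMap (Fin a × Fin b) (Fin a' × Fin b')}

theorem IsOneWayLOCC.isLOCC (h : IsOneWayLOCC Λ) : IsLOCC Λ := by
  obtain ⟨k, E, F, hE, hF, rfl⟩ := h
  have hcomp : ∀ i, tensorMap (E i) (F i) =
      tensorMap LinearMap.id (F i) ∘ₗ ampLeft (Fin b) (E i) := fun i =>
    tensorMap_eq_ampRight_comp_ampLeft (E i) (F i)
  simp only [hcomp]
  exact .alice E hE _ fun i => .done _ _ isCPTP_id (hF i)

theorem IsLOCC.isCPTP (h : IsLOCC Λ) : IsCPTP Λ := by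
  induction h with
  | done E F hE hF => exact ⟨hE.1.tensorMap hF.1, hE.2.tensorMap hF.2⟩
  | alice E hE Λ _ ih =>
    refine ⟨isCP_sum fun i _ => (ih i).1.comp (hE.1 i).ampLeft,
      IsTP.sum_comp (fun i _ => (ih i).2) ?_⟩
    rw [← ampLeft_sum]
    exact hE.2.ampLeft
  | bob F hF Λ _ ih =>
    refine ⟨isCP_sum fun i _ => (ih i).1.comp (hF.1 i).ampRight,
      IsTP.sum_comp (fun i _ => (ih i).2) ?_⟩
    rw [← ampRight_sum]
    exact hF.2.ampRight

theorem IsLOCC.isCP_partialTransposeConj (h : IsLOCC Λ) : IsCP (partialTransposeConj Λ) := by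
  induction h with
  | done E F hE hF =>
    rw [partialTransposeConj_tensorMap]
    exact hE.1.tensorMap hF.1.transposeConj
  | alice E hE Λ _ ih =>
    simp only [partialTransposeConj_sum, partialTransposeConj_comp_ampLeft]
    exact isCP_sum fun i _ => (ih i).comp (hE.1 i).ampLeft
  | bob F hF Λ _ ih =>
    simp only [partialTransposeConj_sum, partialTransposeConj_comp_ampRight]
    exact isCP_sum fun i _ => (ih i).comp (hF.1 i).transposeConj.ampRight

theorem IsLOCC.apply_kronecker_mem_sepCone (h : IsLOCC Λ) :
    ∀ {A : Matrix (Fin a) (Fin a) ℂ} {B : Matrix (Fin b) (Fin b) ℂ},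
      A.PosSemidef → B.PosSemidef → Λ (A ⊗ₖ B) ∈ sepCone (Fin a') (Fin b') := by
  induction h with
  | done E F hE hF =>
    intro A B hA hB
    rw [tensorMap_kronecker]
    exact kronecker_mem_sepCone (hE.1.posSemidef hA) (hF.1.posSemidef hB)
  | alice E hE Λ _ ih =>
    intro A B hA hB
    rw [LinearMap.sum_apply]
    refine sum_mem fun i _ => ?_
    rw [LinearMap.comp_apply, ampLeft_kronecker]
    exact ih i ((hE.1 i).posSemidef hA) hB
  | bob F hF Λ _ ih =>
    intro A B hA hB
    rw [LinearMap.sum_apply]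
    refine sum_mem fun i _ => ?_
    rw [LinearMap.comp_apply, ampRight_kronecker]
    exact ih i hA ((hF.1 i).posSemidef hB)

theorem IsLOCC.mem_PPT (h : IsLOCC Λ) : OpClass.PPT.Mem Λ :=
  ⟨h.isCPTP, choi_partialTransposeConj Λ ▸
    (posSemidef_choi_iff _).mpr h.isCP_partialTransposeConj.posSemidef_ungroupedChoi⟩

theorem IsLOCC.mem_SEPP (h : IsLOCC Λ) : OpClass.SEPP.Mem Λ := by
  refine ⟨h.isCPTP, convexHull_min ?_
    ((convex_convexHull ℝ _).linear_preimage (Λ.restrictScalars ℝ))⟩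
  rintro _ ⟨φ, η, hφ, hη, rfl⟩
  refine mem_SEP_of_mem_sepCone ?_ ((h.isCPTP.2 _).trans (trace_proj_mul hφ hη))
  rw [proj_mul_eq_kronecker]
  exact h.apply_kronecker_mem_sepCone (posSemidef_proj _) (posSemidef_proj _)

theorem isPositiveMap_partialTransposeConj_of_mem_PPT (h : OpClass.PPT.Mem Λ) :
    IsPositiveMap (partialTransposeConj Λ) :=
  isPositiveMap_of_posSemidef_ungroupedChoi <|
    (posSemidef_choi_iff _).mp (choi_partialTransposeConj Λ ▸ h.2)

theorem mem_PPTplusPreserving_of_mem_PPT (h : OpClass.PPT.Mem Λ) :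
    OpClass.PPTplusPreserving.Mem Λ :=
  ⟨h.1, fun _ ⟨htr, hX, hXΓ⟩ => ⟨(h.1.2 _).trans htr, h.1.1.posSemidef hX,
    isPositiveMap_partialTransposeConj_of_mem_PPT h _ hXΓ⟩⟩

theorem mem_RainsPreserving_of_mem_PPT (h : OpClass.PPT.Mem Λ) :
    OpClass.RainsPreserving.Mem Λ :=
  ⟨h.1, fun _ ⟨hX, hXΓ⟩ => ⟨h.1.1.posSemidef hX,
    ((isPositiveMap_partialTransposeConj_of_mem_PPT h).traceNorm_apply_le
      (IsTP.partialTransposeConj h.1.2) (isHermitian_partialTranspose hX.isHermitian)).trans hXΓ⟩⟩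

theorem OpClass.mem_of_isOneWayLOCC (h : IsOneWayLOCC Λ) : ∀ O : OpClass, O.Mem Λ
  | .oneWayLOCC => h
  | .LOCC => h.isLOCC
  | .PPT => h.isLOCC.mem_PPT
  | .RainsPreserving => mem_RainsPreserving_of_mem_PPT h.isLOCC.mem_PPT
  | .PPTplusPreserving => mem_PPTplusPreserving_of_mem_PPT h.isLOCC.mem_PPT
  | .SEPP => h.isLOCC.mem_SEPP

/-- The common relaxation of the six classes of operations that yields the upper bound on the
fidelity: positive trace-preserving maps that send pure product states into the Rains set. -/
structure MapsProductToRains {α β α' β' : Type} [Fintype α] [Fintype β] [Fintype α'] [Fintype β']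
    [DecidableEq α'] [DecidableEq β'] (Λ : MatMap (α × β) (α' × β')) : Prop where
  isPositiveMap : IsPositiveMap Λ
  isTP : IsTP Λ
  apply_mem_Rains (φ : EuclideanSpace ℂ α) (η : EuclideanSpace ℂ β) (hφ : ‖φ‖ = 1)
    (hη : ‖η‖ = 1) : Λ (proj fun p : α × β => φ p.1 * η p.2) ∈ Rains α' β'

theorem OpClass.Mem.mapsProductToRains {O : OpClass} (h : O.Mem Λ) : MapsProductToRains Λ := by
  have of_mem_PPT (h : PPT.Mem Λ) : MapsProductToRains Λ :=
    ⟨h.1.1.isPositiveMap, h.1.2, fun φ η hφ hη => (mem_RainsPreserving_of_mem_PPT h).2 _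
      (PPTplus_subset_Rains (SEP_subset_PPTplus (proj_mul_mem_SEP hφ hη)))⟩
  match O, h with
  | .oneWayLOCC, h => exact of_mem_PPT (IsOneWayLOCC.isLOCC h).mem_PPT
  | .LOCC, h => exact of_mem_PPT (IsLOCC.mem_PPT h)
  | .PPT, h => exact of_mem_PPT h
  | .RainsPreserving, h =>
    exact ⟨h.1.1.isPositiveMap, h.1.2, fun φ η hφ hη =>
      h.2 _ (PPTplus_subset_Rains (SEP_subset_PPTplus (proj_mul_mem_SEP hφ hη)))⟩
  | .PPTplusPreserving, h =>
    exact ⟨h.1.1.isPositiveMap, h.1.2, fun φ η hφ hη =>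
      PPTplus_subset_Rains (h.2 _ (SEP_subset_PPTplus (proj_mul_mem_SEP hφ hη)))⟩
  | .SEPP, h =>
    exact ⟨h.1.1.isPositiveMap, h.1.2, fun φ η hφ hη =>
      PPTplus_subset_Rains (SEP_subset_PPTplus (h.2 _ (proj_mul_mem_SEP hφ hη)))⟩

end Hierarchy

section Overlap

variable {ι : Type} [Fintype ι] {m : ℕ}

variable (m) in
/-- The overlap `Tr(X Ψ_m)` with the maximally entangled state, as a linear functional. -/
noncomputable def overlap : Matrix (Fin m × Fin m) (Fin m × Fin m) ℂ →ₗ[ℂ] ℂ :=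
  traceLinearMap _ ℂ ℂ ∘ₗ LinearMap.mulRight ℂ (proj (maxEntVec m))

theorem re_trace_conjTranspose_mul_proj_maxEntVec
    (X : Matrix (Fin m × Fin m) (Fin m × Fin m) ℂ) :
    (Xᴴ * proj (maxEntVec m)).trace.re = (overlap m X).re := by
  rw [← (posSemidef_proj (maxEntVec m)).isHermitian.eq, ← conjTranspose_mul, trace_conjTranspose,
    trace_mul_comm, Complex.star_def, Complex.conj_re]
  rfl

theorem overlap_nonneg {X : Matrix (Fin m × Fin m) (Fin m × Fin m) ℂ} (hX : X.PosSemidef) :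
    0 ≤ overlap m X :=
  trace_mul_nonneg hX (posSemidef_proj _)

theorem overlap_eq_sum (X : Matrix (Fin m × Fin m) (Fin m × Fin m) ℂ) :
    overlap m X = 1 / m * ∑ i, ∑ j, X (i, i) (j, j) := by
  have hsq : ((√(m : ℝ) : ℂ))⁻¹ * (√(m : ℝ) : ℂ)⁻¹ = (m : ℂ)⁻¹ := by
    rw [← mul_inv, ← Complex.ofReal_mul, Real.mul_self_sqrt m.cast_nonneg, Complex.ofReal_natCast]
  simp [overlap, trace, Matrix.mul_apply, proj, vecMulVec_apply, maxEntVec,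
    Fintype.sum_prod_type, hsq, Finset.mul_sum, mul_comm, apply_ite (starRingEnd ℂ)]

theorem overlap_proj (u : Fin m × Fin m → ℂ) :
    overlap m (proj u) = 1 / m * (‖∑ i, u (i, i)‖ : ℂ) ^ 2 := by
  rw [overlap_eq_sum, ← Complex.mul_conj', map_sum, Finset.sum_mul_sum]
  rfl

theorem proj_le_one [DecidableEq ι] {v : EuclideanSpace ℂ ι} (hv : ‖v‖ = 1) :
    proj v.ofLp ≤ (1 : Matrix ι ι ℂ) := by
  refine IsStarProjection.le_one ⟨?_, (posSemidef_proj _).isHermitian⟩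
  have h : star v.ofLp ⬝ᵥ v.ofLp = 1 := by
    rw [dotProduct_comm, ← EuclideanSpace.inner_eq_star_dotProduct, inner_self_eq_norm_sq_to_K, hv]
    simp
  rw [IsIdempotentElem, proj, vecMulVec_mul_vecMulVec, h, one_smul]

theorem norm_maxEntVec (hm : 1 ≤ m) :
    ‖(WithLp.toLp 2 (maxEntVec m) : EuclideanSpace ℂ (Fin m × Fin m))‖ = 1 := by
  have hm' : (m : ℝ) ≠ 0 := by positivity
  rw [EuclideanSpace.norm_eq]
  simp [maxEntVec, Fintype.sum_prod_type, apply_ite norm, ite_pow, hm']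

theorem re_overlap_le_trace (hm : 1 ≤ m) {X : Matrix (Fin m × Fin m) (Fin m × Fin m) ℂ}
    (hX : X.PosSemidef) : (overlap m X).re ≤ X.trace.re := by
  have h := re_trace_mul_le_of_le (proj_le_one (norm_maxEntVec hm)) hX
  rwa [Matrix.one_mul, trace_mul_comm] at h

theorem le_one_of_mul_self_eq_one [DecidableEq ι] {S : Matrix ι ι ℂ} (hS : S.IsHermitian)
    (hSS : S * S = 1) : S ≤ 1 := by
  have h : 1 - S = (2⁻¹ : ℝ) • ((1 - S)ᴴ * (1 - S)) := by
    rw [conjTranspose_sub, conjTranspose_one, hS.eq, Matrix.sub_mul, Matrix.one_mul,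
      Matrix.mul_sub, Matrix.mul_one, hSS]
    module
  rw [le_iff, h]
  exact (posSemidef_conjTranspose_mul_self _).smul (by norm_num)

/-- The flip operator `x ⊗ y ↦ y ⊗ x`. -/
def swap (m : ℕ) : Matrix (Fin m × Fin m) (Fin m × Fin m) ℂ :=
  (1 : Matrix (Fin m × Fin m) (Fin m × Fin m) ℂ).submatrix Prod.swap id

theorem isHermitian_swap : (swap m).IsHermitian := by
  ext p q
  simp [swap, Matrix.one_apply, Prod.ext_iff, and_comm, eq_comm]

theorem swap_mul (X : Matrix (Fin m × Fin m) (Fin m × Fin m) ℂ) :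
    swap m * X = X.submatrix Prod.swap id := by
  ext p q
  simp [swap, Matrix.mul_apply, Matrix.one_apply]

theorem swap_mul_self : swap m * swap m = 1 := by
  rw [swap_mul, swap, submatrix_submatrix]
  simp

theorem overlap_eq_trace_swap_mul (X : Matrix (Fin m × Fin m) (Fin m × Fin m) ℂ) :
    overlap m X = 1 / m * (swap m * partialTranspose X).trace := by
  rw [overlap_eq_sum, swap_mul, trace, Fintype.sum_prod_type, Finset.sum_comm]
  rfl

theorem re_overlap_le_of_mem_Rains {X : Matrix (Fin m × Fin m) (Fin m × Fin m) ℂ}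
    (hX : X ∈ Rains (Fin m) (Fin m)) : (overlap m X).re ≤ 1 / m := by
  have hle : swap m ≤ 1 := le_one_of_mul_self_eq_one isHermitian_swap swap_mul_self
  have hge : -1 ≤ swap m := neg_le.mp <|
    le_one_of_mul_self_eq_one isHermitian_swap.neg (by rw [neg_mul_neg, swap_mul_self])
  have h : (swap m * partialTranspose X).trace.re ≤ 1 :=
    (re_trace_mul_le_traceNorm hge hle (isHermitian_partialTranspose hX.1.isHermitian)).trans hX.2
  have hre : (overlap m X).re = 1 / m * (swap m * partialTranspose X).trace.re := by
    rw [overlap_eq_trace_swap_mul, ← Complex.re_ofReal_mul]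
    push_cast
    rfl
  rw [hre]
  exact mul_le_of_le_one_right (by positivity) h

end Overlap

section UpperBound

theorem posSemidef_of_forall_nonneg {ι : Type} [Fintype ι] {W : Matrix ι ι ℂ}
    (h : ∀ u : ι → ℂ, 0 ≤ star u ⬝ᵥ W *ᵥ u) : W.PosSemidef := by
  classical
  rw [← isPositive_toEuclideanLin_iff, LinearMap.isPositive_iff_complex]
  intro u
  have hu := Complex.le_def.mp (h u.ofLp)
  have hinner : inner ℂ (toEuclideanLin W u) u = star (star u.ofLp ⬝ᵥ W *ᵥ u.ofLp) := by
    rw [EuclideanSpace.inner_eq_star_dotProduct, ← star_dotProduct_star, star_star, dotProduct_comm]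
    rfl
  rw [hinner]
  exact ⟨Complex.ext (by simp) (by simpa using hu.2.symm), hu.1⟩

theorem exists_apply_proj_eq_norm_sq {ι : Type} [Fintype ι] {ℓ : Matrix ι ι ℂ →ₗ[ℂ] ℂ}
    (hℓ : ∀ X, X.PosSemidef → 0 ≤ ℓ X) :
    ∃ T : EuclideanSpace ℂ ι →ₗ[ℂ] EuclideanSpace ℂ ι,
      ∀ u : EuclideanSpace ℂ ι, ℓ (proj u) = (‖T u‖ : ℂ) ^ 2 := by
  classical
  set W : Matrix ι ι ℂ := of fun p q => ℓ (single q p 1) with hW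
  have hform (u : ι → ℂ) : star u ⬝ᵥ W *ᵥ u = ℓ (proj u) := by
    rw [proj_eq_sum_single, Finset.sum_comm]
    simp only [map_sum, map_smul, dotProduct, mulVec, hW, of_apply, Finset.mul_sum,
      Pi.star_apply, smul_eq_mul]
    exact Finset.sum_congr rfl fun p _ => Finset.sum_congr rfl fun q _ => by ring
  have hWpos : W.PosSemidef := posSemidef_of_forall_nonneg fun u =>
    (hform u).symm ▸ hℓ _ (posSemidef_proj u)
  obtain ⟨C, hC⟩ := CStarAlgebra.nonneg_iff_eq_star_mul_self.mp hWpos.nonneg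
  refine ⟨toEuclideanLin C, fun u => ?_⟩
  rw [← hform, hC, star_eq_conjTranspose, ← mulVec_mulVec, dotProduct_mulVec, ← star_mulVec,
    dotProduct_comm]
  exact inner_self_eq_norm_sq_to_K (𝕜 := ℂ) (toEuclideanLin C u)

theorem le_distNorm {d m : ℕ} {x : Fin d → ℂ} {r : ℝ}
    (h : ∀ y z, x = y + z → r ≤ ∑ i, ‖y i‖ + √(m : ℝ) * √(∑ i, ‖z i‖ ^ 2)) :
    r ≤ distNorm m x := by
  refine le_csInf ⟨_, x, 0, (add_zero x).symm, rfl⟩ ?_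
  rintro _ ⟨y, z, hx, rfl⟩
  exact h y z hx

theorem norm_sum_smul_of_orthonormal {κ E : Type*} [Fintype κ] [NormedAddCommGroup E]
    [InnerProductSpace ℂ E] {g : κ → E} (hg : Orthonormal ℂ g) (z : κ → ℂ) :
    ‖∑ i, z i • g i‖ = √(∑ i, ‖z i‖ ^ 2) := by
  rw [norm_eq_sqrt_re_inner (𝕜 := ℂ), hg.inner_sum]
  simp only [Complex.conj_mul', ← Complex.ofReal_pow, ← Complex.ofReal_sum, RCLike.re_to_complex,
    Complex.ofReal_re]

theorem sqrt_mul_norm_apply_sum_le_distNorm {d m : ℕ} {E F : Type*} [NormedAddCommGroup E]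
    [InnerProductSpace ℂ E] [SeminormedAddCommGroup F] [NormedSpace ℂ F] {T : E →ₗ[ℂ] F}
    (hT : ∀ u, ‖T u‖ ≤ ‖u‖) {g : Fin d → E} (hg : Orthonormal ℂ g)
    (hTg : ∀ i, √(m : ℝ) * ‖T (g i)‖ ≤ 1) (x : Fin d → ℂ) :
    √(m : ℝ) * ‖T (∑ i, x i • g i)‖ ≤ distNorm m x := by
  refine le_distNorm fun y z hx => ?_
  have hy : √(m : ℝ) * ‖T (∑ i, y i • g i)‖ ≤ ∑ i, ‖y i‖ :=
    calc √(m : ℝ) * ‖T (∑ i, y i • g i)‖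
        ≤ √(m : ℝ) * ∑ i, ‖y i‖ * ‖T (g i)‖ := by
          rw [map_sum]
          gcongr
          exact norm_sum_le_of_le _ fun i _ => by rw [map_smul, norm_smul]
      _ = ∑ i, ‖y i‖ * (√(m : ℝ) * ‖T (g i)‖) := by
          rw [Finset.mul_sum]
          exact Finset.sum_congr rfl fun i _ => by ring
      _ ≤ ∑ i, ‖y i‖ :=
          Finset.sum_le_sum fun i _ => mul_le_of_le_one_right (norm_nonneg _) (hTg i)
  have hz : ‖T (∑ i, z i • g i)‖ ≤ √(∑ i, ‖z i‖ ^ 2) :=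
    (hT _).trans_eq (norm_sum_smul_of_orthonormal hg z)
  calc √(m : ℝ) * ‖T (∑ i, x i • g i)‖
      = √(m : ℝ) * ‖T (∑ i, y i • g i) + T (∑ i, z i • g i)‖ := by
        simp only [hx, Pi.add_apply, add_smul, Finset.sum_add_distrib, map_add]
    _ ≤ √(m : ℝ) * ‖T (∑ i, y i • g i)‖ + √(m : ℝ) * ‖T (∑ i, z i • g i)‖ := by
        rw [← mul_add]
        gcongr
        exact norm_add_le _ _
    _ ≤ ∑ i, ‖y i‖ + √(m : ℝ) * √(∑ i, ‖z i‖ ^ 2) := by gcongr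

variable {α β : Type} [Fintype α] [Fintype β]

theorem orthonormal_mul {κ : Type*} {e : κ → EuclideanSpace ℂ α} {f : κ → EuclideanSpace ℂ β}
    (he : Orthonormal ℂ e) (hf : Orthonormal ℂ f) :
    Orthonormal ℂ fun i =>
      (WithLp.toLp 2 fun p => e i p.1 * f i p.2 : EuclideanSpace ℂ (α × β)) := by
  classical
  have hinner (i j : κ) :
      inner ℂ (WithLp.toLp 2 fun p => e i p.1 * f i p.2 : EuclideanSpace ℂ (α × β))
        (WithLp.toLp 2 fun p => e j p.1 * f j p.2) = inner ℂ (e i) (e j) * inner ℂ (f i) (f j) := by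
    simp only [PiLp.inner_apply, RCLike.inner_apply, map_mul, Fintype.sum_prod_type,
      Finset.sum_mul_sum]
    exact Finset.sum_congr rfl fun x _ => Finset.sum_congr rfl fun y _ => by ring
  rw [orthonormal_iff_ite] at *
  intro i j
  rw [hinner, he, hf]
  split_ifs <;> simp

theorem MapsProductToRains.re_overlap_le {d m : ℕ} {Λ : MatMap (α × β) (Fin m × Fin m)}
    (hΛ : MapsProductToRains Λ) (hm : 1 ≤ m) {e : Fin d → EuclideanSpace ℂ α}
    {f : Fin d → EuclideanSpace ℂ β} (he : Orthonormal ℂ e) (hf : Orthonormal ℂ f)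
    {x : Fin d → ℂ} {ψ : α × β → ℂ} (hψ : ∀ p, ψ p = ∑ i, x i * (e i p.1 * f i p.2)) :
    (overlap m (Λ (proj ψ))).re ≤ 1 / m * distNorm m x ^ 2 := by
  obtain ⟨T, hT⟩ := exists_apply_proj_eq_norm_sq (ℓ := overlap m ∘ₗ Λ)
    fun X hX => overlap_nonneg (hΛ.isPositiveMap X hX)
  have hT_re (u : EuclideanSpace ℂ (α × β)) : (overlap m (Λ (proj u))).re = ‖T u‖ ^ 2 := by
    rw [← LinearMap.comp_apply, hT]
    norm_cast
  set g : Fin d → EuclideanSpace ℂ (α × β) := fun i => WithLp.toLp 2 fun p => e i p.1 * f i p.2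
  have hT_le (u) : ‖T u‖ ≤ ‖u‖ := by
    refine le_of_sq_le_sq ?_ (norm_nonneg _)
    have h := re_overlap_le_trace hm (hΛ.isPositiveMap _ (posSemidef_proj u.ofLp))
    rw [hT_re, hΛ.isTP, trace_proj] at h
    exact_mod_cast h
  have hm' : (0 : ℝ) < m := by positivity
  have hTg (i) : √(m : ℝ) * ‖T (g i)‖ ≤ 1 := by
    have h := re_overlap_le_of_mem_Rains (hΛ.apply_mem_Rains (e i) (f i) (he.1 i) (hf.1 i))
    rw [show (fun p : α × β => e i p.1 * f i p.2) = g i from rfl, hT_re, le_div_iff₀' hm'] at h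
    rwa [← Real.sqrt_sq (norm_nonneg (T (g i))), ← Real.sqrt_mul hm'.le, Real.sqrt_le_one]
  have hψg : ψ = (∑ i, x i • g i : EuclideanSpace ℂ (α × β)).ofLp := by
    ext p
    simp [hψ p, g]
  have h := sqrt_mul_norm_apply_sum_le_distNorm hT_le (orthonormal_mul he hf) hTg x
  rw [hψg, hT_re, one_div, le_inv_mul_iff₀ hm', ← Real.sq_sqrt hm'.le, ← mul_pow]
  gcongr

end UpperBound

section Duality

variable {d m : ℕ}

theorem distNorm_le {x y z : Fin d → ℂ} (h : x = y + z) :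
    distNorm m x ≤ ∑ i, ‖y i‖ + √(m : ℝ) * √(∑ i, ‖z i‖ ^ 2) := by
  refine csInf_le ⟨0, ?_⟩ ⟨y, z, h, rfl⟩
  rintro _ ⟨y, z, -, rfl⟩
  positivity

theorem distNorm_nonneg (x : Fin d → ℂ) : 0 ≤ distNorm m x :=
  le_distNorm fun _ _ _ => by positivity

theorem distNorm_le_sum_norm (x : Fin d → ℂ) : distNorm m x ≤ ∑ i, ‖x i‖ := by
  simpa using distNorm_le (m := m) (add_zero x).symm

theorem exists_sum_min_sq_eq_mul_sq {ι : Type*} [Fintype ι] {ξ : ι → ℝ} (hm : 1 ≤ m)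
    (hξ : ∀ i, 0 ≤ ξ i) (hcard : m < #{i | 0 < ξ i}) :
    ∃ t > 0, ∑ i, min t (ξ i) ^ 2 = m * t ^ 2 := by
  obtain ⟨i₀, hi₀, hmin⟩ :=
    ({i | 0 < ξ i} : Finset ι).exists_min_image ξ (Finset.card_pos.mp (by lia))
  have hpos : 0 < ξ i₀ := (Finset.mem_filter.mp hi₀).2
  have hsmall : m * ξ i₀ ^ 2 ≤ ∑ i, min (ξ i₀) (ξ i) ^ 2 :=
    calc m * ξ i₀ ^ 2 ≤ #{i | 0 < ξ i} * ξ i₀ ^ 2 := by gcongr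
      _ = ∑ i with 0 < ξ i, min (ξ i₀) (ξ i) ^ 2 := by
        rw [← nsmul_eq_mul, ← Finset.sum_const]
        exact Finset.sum_congr rfl fun i hi => by rw [min_eq_left (hmin i hi)]
      _ ≤ ∑ i, min (ξ i₀) (ξ i) ^ 2 :=
        Finset.sum_le_univ_sum_of_nonneg fun i => sq_nonneg _
  set T := max (ξ i₀) √(∑ i, ξ i ^ 2)
  have hT : 0 ≤ T := hpos.le.trans (le_max_left _ _)
  have hlarge : ∑ i, min T (ξ i) ^ 2 ≤ m * T ^ 2 :=
    calc ∑ i, min T (ξ i) ^ 2 ≤ ∑ i, ξ i ^ 2 := Finset.sum_le_sum fun i _ =>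
          pow_le_pow_left₀ (le_min hT (hξ i)) (min_le_right _ _) 2
      _ ≤ T ^ 2 := (Real.sqrt_le_left hT).mp (le_max_right _ _)
      _ ≤ m * T ^ 2 := le_mul_of_one_le_left (sq_nonneg T) (by exact_mod_cast hm)
  have hcont : Continuous fun t : ℝ => ∑ i, min t (ξ i) ^ 2 - m * t ^ 2 := by fun_prop
  obtain ⟨t, ht, h⟩ := intermediate_value_Icc' (le_max_left _ _) hcont.continuousOn
    ⟨sub_nonpos.mpr hlarge, sub_nonneg.mpr hsmall⟩
  exact ⟨t, hpos.trans_le ht.1, sub_eq_zero.mp h⟩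

theorem distNorm_le_sum_min_div_mul {ξ : Fin d → ℝ} {t : ℝ} (ht : 0 < t)
    (hsum : ∑ i, min t (ξ i) ^ 2 = m * t ^ 2) :
    distNorm m (fun i => (ξ i : ℂ)) ≤ ∑ i, min t (ξ i) / t * ξ i := by
  have hsplit : (fun i => (ξ i : ℂ)) =
      (fun i => ((ξ i - min t (ξ i) : ℝ) : ℂ)) + fun i => ((min t (ξ i) : ℝ) : ℂ) := by
    ext i
    simp
  calc distNorm m (fun i => (ξ i : ℂ))
      ≤ ∑ i, |ξ i - min t (ξ i)| + √(m : ℝ) * √(∑ i, min t (ξ i) ^ 2) := by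
        simpa only [Complex.norm_real, Real.norm_eq_abs, sq_abs] using distNorm_le (m := m) hsplit
    _ = ∑ i, |ξ i - min t (ξ i)| + ∑ i, min t (ξ i) ^ 2 / t := by
        rw [← Finset.sum_div, hsum, Real.sqrt_mul m.cast_nonneg, Real.sqrt_sq ht.le, ← mul_assoc,
          Real.mul_self_sqrt m.cast_nonneg]
        field_simp
    _ = ∑ i, min t (ξ i) / t * ξ i := by
        rw [← Finset.sum_add_distrib]
        refine Finset.sum_congr rfl fun i _ => ?_
        rw [abs_of_nonneg (sub_nonneg.mpr (min_le_right _ _))]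
        rcases le_total t (ξ i) with h | h
        · rw [min_eq_left h]
          field_simp
          ring
        · rw [min_eq_right h]
          field_simp
          ring

theorem exists_distNorm_le_sum_mul {ξ : Fin d → ℝ} (hm : 1 ≤ m) (hξ : ∀ i, 0 ≤ ξ i) :
    ∃ w : Fin d → ℝ, (∀ i, 0 ≤ w i) ∧ (∀ i, w i ≤ 1) ∧ ∑ i, w i ^ 2 ≤ m ∧
      distNorm m (fun i => (ξ i : ℂ)) ≤ ∑ i, w i * ξ i := by
  rcases le_or_gt #{i | 0 < ξ i} m with hcard | hcard
  · refine ⟨fun i => if 0 < ξ i then 1 else 0, fun i => by positivity, fun i => ?_, ?_, ?_⟩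
    · dsimp only
      split_ifs <;> norm_num
    · simpa [ite_pow] using hcard
    · refine (distNorm_le_sum_norm _).trans_eq (Finset.sum_congr rfl fun i _ => ?_)
      rcases (hξ i).eq_or_lt with h | h
      · simp [← h]
      · simp [h, abs_of_pos]
  · obtain ⟨t, ht, hsum⟩ := exists_sum_min_sq_eq_mul_sq hm hξ hcard
    refine ⟨fun i => min t (ξ i) / t, fun i => div_nonneg (le_min ht.le (hξ i)) ht.le,
      fun i => (div_le_one ht).mpr (min_le_left _ _), ?_, distNorm_le_sum_min_div_mul ht hsum⟩
    simp only [div_pow, ← Finset.sum_div, hsum]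
    field_simp
    exact le_rfl

end Duality

section Hypersimplex

variable {ι μ : Type*}

/-- The partial matching between `ι` and `μ` formed by the pairs `(i, r)` that the permutation `σ`
of the disjoint union sends from `i` to `r`. -/
def crossing (σ : Equiv.Perm (ι ⊕ μ)) : ι ≃. μ where
  toFun i := (σ (.inl i)).getRight?
  invFun r := (σ.symm (.inr r)).getLeft?
  inv i r := by
    simp only [Sum.getRight?_eq_some_iff, Sum.getLeft?_eq_some_iff, Equiv.symm_apply_eq]
    exact eq_comm

/-- The indicator function of the domain of a partial matching. -/
def domIndicator (g : ι ≃. μ) (i : ι) : ℝ := if (g i).isSome then 1 else 0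

theorem domIndicator_le_one (g : ι ≃. μ) (i : ι) : domIndicator g i ≤ 1 := by
  unfold domIndicator
  split_ifs <;> simp

variable [Fintype μ]

theorem sum_permMatrix_inl_inr [DecidableEq ι] [DecidableEq μ] (σ : Equiv.Perm (ι ⊕ μ)) (i : ι) :
    ∑ r, σ.permMatrix ℝ (.inl i) (.inr r) = domIndicator (crossing σ) i := by
  cases h : σ (.inl i) with
  | inl j => simp [Equiv.Perm.permMatrix, PEquiv.toMatrix_apply, domIndicator, crossing, h]
  | inr r => simp [Equiv.Perm.permMatrix, PEquiv.toMatrix_apply, domIndicator, crossing, h]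

variable [Fintype ι]

theorem fromBlocks_mem_doublyStochastic [DecidableEq ι] [DecidableEq μ] [Nonempty μ] {c : ι → ℝ}
    (h₀ : ∀ i, 0 ≤ c i) (h₁ : ∀ i, c i ≤ 1) (hc : ∑ i, c i ≤ Fintype.card μ) :
    fromBlocks (diagonal fun i => 1 - c i) (of fun i _ => c i / Fintype.card μ)
      (of fun _ i => c i / Fintype.card μ) (diagonal fun _ => 1 - (∑ i, c i) / Fintype.card μ) ∈
        doublyStochastic ℝ (ι ⊕ μ) := by
  have hcard : (0 : ℝ) < Fintype.card μ := by exact_mod_cast Fintype.card_pos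
  refine mem_doublyStochastic_iff_sum.mpr ⟨?_, ?_, ?_⟩
  · have := (div_le_one hcard).mpr hc
    have := fun i => div_nonneg (h₀ i) hcard.le
    rintro (i | r) (j | s) <;> simp [diagonal_apply, *] <;> split_ifs <;> simp [*]
  all_goals rintro (i | r) <;> simp [diagonal_apply, ← Finset.sum_div, mul_div_cancel₀, hcard.ne']

theorem mem_convexHull_range_domIndicator [Nonempty μ] {c : ι → ℝ} (h₀ : ∀ i, 0 ≤ c i)
    (h₁ : ∀ i, c i ≤ 1) (hc : ∑ i, c i ≤ Fintype.card μ) :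
    c ∈ convexHull ℝ (Set.range (domIndicator : (ι ≃. μ) → ι → ℝ)) := by
  classical
  let T : Matrix (ι ⊕ μ) (ι ⊕ μ) ℝ →ₗ[ℝ] ι → ℝ :=
    { toFun := fun M i => ∑ r, M (.inl i) (.inr r)
      map_add' := fun M N => by ext; simp [Finset.sum_add_distrib]
      map_smul' := fun t M => by ext; simp [Finset.mul_sum] }
  have hM := fromBlocks_mem_doublyStochastic h₀ h₁ hc
  rw [← SetLike.mem_coe, doublyStochastic_eq_convexHull_permMatrix] at hM
  have hTM := Set.mem_image_of_mem T hM
  rw [T.image_convexHull] at hTM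
  convert convexHull_mono ?_ hTM
  · ext i
    simp [T, mul_div_cancel₀]
  · rintro _ ⟨_, ⟨σ, rfl⟩, rfl⟩
    exact ⟨crossing σ, funext fun i => (sum_permMatrix_inl_inr σ i).symm⟩

end Hypersimplex

section Kraus

variable {α β α' β' : Type}

/-- The completely positive map `X ↦ K X Kᴴ` with the single Kraus operator `K`. -/
def kraus [Fintype α] (K : Matrix α' α ℂ) : MatMap α α' where
  toFun X := K * X * Kᴴ
  map_add' X Y := by rw [Matrix.mul_add, Matrix.add_mul]
  map_smul' c X := by simp

theorem kraus_apply [Fintype α] (K : Matrix α' α ℂ) (X : Matrix α α ℂ) :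
    kraus K X = K * X * Kᴴ :=
  rfl

theorem kraus_proj [Fintype α] (K : Matrix α' α ℂ) (v : α → ℂ) :
    kraus K (proj v) = proj (K *ᵥ v) := by
  rw [kraus_apply, proj, mul_vecMulVec, vecMulVec_mul, proj, star_mulVec]

theorem kraus_kronecker [Fintype α] [Fintype β] (K : Matrix α' α ℂ) (L : Matrix β' β ℂ)
    (A : Matrix α α ℂ) (B : Matrix β β ℂ) :
    kraus (K ⊗ₖ L) (A ⊗ₖ B) = kraus K A ⊗ₖ kraus L B := by
  simp only [kraus_apply, conjTranspose_kronecker, mul_kronecker_mul]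

theorem tensorMap_kraus [Fintype α] [Fintype β] (K : Matrix α' α ℂ) (L : Matrix β' β ℂ) :
    tensorMap (kraus K) (kraus L) = kraus (K ⊗ₖ L) :=
  linearMap_ext_kronecker fun A B => by rw [tensorMap_kronecker, kraus_kronecker]

variable [Fintype α]

theorem isCP_kraus [Finite α'] (K : Matrix α' α ℂ) : IsCP (kraus K) := by
  intro n X hX
  have h : ampRight (Fin n) (kraus K) = kraus ((1 : Matrix (Fin n) (Fin n) ℂ) ⊗ₖ K) :=
    linearMap_ext_kronecker fun A B => by
      rw [ampRight_kronecker, kraus_kronecker, kraus_apply 1, conjTranspose_one, Matrix.one_mul,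
        Matrix.mul_one]
  rw [h]
  exact hX.mul_mul_conjTranspose_same _

variable [Fintype α']

theorem trace_kraus_apply (K : Matrix α' α ℂ) (X : Matrix α α ℂ) :
    (kraus K X).trace = (Kᴴ * K * X).trace := by
  rw [kraus_apply, trace_mul_comm, ← Matrix.mul_assoc]

theorem exists_sum_conjTranspose_mul_self_eq [Nonempty α'] {W : Matrix α α ℂ}
    (hW : W.PosSemidef) : ∃ L : α → Matrix α' α ℂ, ∑ j, (L j)ᴴ * L j = W := by
  classical
  obtain ⟨C, rfl⟩ := CStarAlgebra.nonneg_iff_eq_star_mul_self.mp hW.nonneg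
  refine ⟨fun j => vecMulVec (Pi.single (Classical.arbitrary α') 1) (C j), ?_⟩
  ext p q
  simp [Matrix.sum_apply, Matrix.mul_apply, vecMulVec_apply, Pi.single_apply]

variable [DecidableEq α]

theorem isTP_sum_kraus {σ : Type*} [Fintype σ] {K : σ → Matrix α' α ℂ}
    (hK : ∑ s, (K s)ᴴ * K s = 1) : IsTP (∑ s, kraus (K s)) := by
  intro X
  simp only [LinearMap.sum_apply, trace_sum, trace_kraus_apply]
  rw [← trace_sum, ← Finset.sum_mul, hK, Matrix.one_mul]

theorem exists_isCP_isTP_sum_kraus_add [Nonempty α'] {σ : Type*} [Fintype σ]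
    {K : σ → Matrix α' α ℂ} (hK : ∑ s, (K s)ᴴ * K s ≤ 1) :
    ∃ R : MatMap α α', IsCP R ∧ IsTP (∑ s, kraus (K s) + R) := by
  obtain ⟨L, hL⟩ := exists_sum_conjTranspose_mul_self_eq (α' := α') (le_iff.mp hK)
  refine ⟨∑ j, kraus (L j), isCP_sum fun j _ => isCP_kraus (L j), ?_⟩
  have h := isTP_sum_kraus (K := Sum.elim K L) (by
    rw [Fintype.sum_sum_type]
    simp only [Sum.elim_inl, Sum.elim_inr, hL, add_sub_cancel])
  rwa [Fintype.sum_sum_type] at h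

theorem exists_isCPTP_add [Nonempty α'] {K : Matrix α' α ℂ} (hK : Kᴴ * K ≤ 1) :
    ∃ R : MatMap α α', IsCP R ∧ IsCPTP (kraus K + R) := by
  obtain ⟨R, hR, hTP⟩ := exists_isCP_isTP_sum_kraus_add (K := fun _ : Unit => K) (by simpa using hK)
  rw [Fintype.sum_unique] at hTP
  exact ⟨R, hR, fun n X hX => (isCP_kraus K n X hX).add (hR n X hX), hTP⟩

end Kraus

section OneWay

variable {a b a' b' : ℕ}

theorem isOneWayLOCC_sum_tensorMap {σ : Type*} [Fintype σ] {E : σ → MatMap (Fin a) (Fin a')}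
    {F : σ → MatMap (Fin b) (Fin b')} (hE : ∀ s, IsCP (E s)) (hTP : IsTP (∑ s, E s))
    (hF : ∀ s, IsCPTP (F s)) : IsOneWayLOCC (∑ s, tensorMap (E s) (F s)) := by
  let ε := (Fintype.equivFin σ).symm
  refine ⟨Fintype.card σ, E ∘ ε, F ∘ ε, ⟨fun i => hE _, ?_⟩, fun i => hF _, ?_⟩
  · rwa [← Equiv.sum_comp ε] at hTP
  · exact (Equiv.sum_comp ε fun s => tensorMap (E s) (F s)).symm

theorem tensorMap_add_right {α β α' β' : Type} (E : MatMap α α') (F G : MatMap β β') :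
    tensorMap E (F + G) = tensorMap E F + tensorMap E G :=
  LinearMap.ext fun X => (ampLeft β' E).map_add (ampRight α F X) (ampRight α G X)

theorem exists_isOneWayLOCC_sum_kraus_kronecker_le [NeZero a'] [NeZero b'] {σ : Type*} [Fintype σ]
    {K : σ → Matrix (Fin a') (Fin a) ℂ} {V : σ → Matrix (Fin b') (Fin b) ℂ}
    (hK : ∑ s, (K s)ᴴ * K s ≤ 1) (hV : ∀ s, (V s)ᴴ * V s ≤ 1) :
    ∃ Λ : MatMap (Fin a × Fin b) (Fin a' × Fin b'), IsOneWayLOCC Λ ∧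
      ∀ X, X.PosSemidef → ∑ s, kraus (K s ⊗ₖ V s) X ≤ Λ X := by
  obtain ⟨R, hR, hTP⟩ := exists_isCP_isTP_sum_kraus_add hK
  choose S hS hVS using fun s => exists_isCPTP_add (hV s)
  obtain ⟨G, -, hG⟩ := exists_isCPTP_add (K := (0 : Matrix (Fin b') (Fin b) ℂ)) (by simp)
  refine ⟨_, isOneWayLOCC_sum_tensorMap (σ := Option σ)
    (E := fun o => o.elim R fun s => kraus (K s)) (F := fun o => o.elim (kraus 0 + G)
    fun s => kraus (V s) + S s) ?_ ?_ ?_, fun X hX => ?_⟩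
  · rintro (_ | s)
    exacts [hR, isCP_kraus (K s)]
  · rwa [Fintype.sum_option, add_comm]
  · rintro (_ | s)
    exacts [hG, hVS s]
  · rw [le_iff]
    simp only [Fintype.sum_option, Option.elim, tensorMap_add_right (kraus _), tensorMap_kraus,
      Finset.sum_add_distrib, LinearMap.add_apply, LinearMap.sum_apply]
    rw [add_left_comm, add_sub_cancel_left]
    exact ((hR.tensorMap hG.1).posSemidef hX).add
      (posSemidef_sum _ fun s _ => ((isCP_kraus (K s)).tensorMap (hS s)).posSemidef hX)

end OneWay

section Transfer

variable {ι α β μ : Type} [DecidableEq ι] [Fintype μ]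

theorem toMatrix_mul_toMatrix_symm [DecidableEq μ] (g : ι ≃. μ) :
    (g.toMatrix : Matrix ι μ ℂ) * (g.symm.toMatrix : Matrix μ ι ℂ) =
      diagonal fun i => (domIndicator g i : ℂ) := by
  rw [← PEquiv.toMatrix_trans, PEquiv.self_trans_symm]
  ext i j
  rcases eq_or_ne i j with rfl | hij
  · cases h : g i <;> simp [PEquiv.ofSet, domIndicator, h]
  · simp [PEquiv.ofSet, hij]

variable [Fintype ι]

theorem conjTranspose_mul_diagonal_mul_le_one [Fintype α] [DecidableEq α]
    {U : Matrix ι α ℂ} (hU : U * Uᴴ = 1) {r : ι → ℝ} (hr : ∀ i, r i ≤ 1) :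
    Uᴴ * diagonal (fun i => (r i : ℂ)) * U ≤ 1 := by
  have hproj : IsStarProjection (Uᴴ * U) := by
    refine ⟨?_, isHermitian_conjTranspose_mul_self U⟩
    rw [IsIdempotentElem, Matrix.mul_assoc, ← Matrix.mul_assoc U, hU, Matrix.one_mul]
  have hdiag : (diagonal fun i => ((1 - r i : ℝ) : ℂ)).PosSemidef :=
    .diagonal fun i => Complex.zero_le_real.mpr (sub_nonneg.mpr (hr i))
  have hsub : Uᴴ * diagonal (fun i => ((1 - r i : ℝ) : ℂ)) * U =
      Uᴴ * U - Uᴴ * diagonal (fun i => (r i : ℂ)) * U := by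
    simp only [Complex.ofReal_sub, Complex.ofReal_one, ← diagonal_sub, diagonal_one,
      Matrix.mul_sub, Matrix.sub_mul, Matrix.mul_one]
  exact (le_iff.mpr (hsub ▸ hdiag.conjTranspose_mul_mul_same U)).trans hproj.le_one

/-- The operator `∑ c i |g i⟩⟨e i|`, summed over the domain of the partial matching `g`, where the
rows of `U` are the bras `⟨e i|`. -/
def transferOp (g : ι ≃. μ) (c : ι → ℝ) (U : Matrix ι α ℂ) : Matrix μ α ℂ :=
  (g.symm.toMatrix : Matrix μ ι ℂ) * diagonal (fun i => (c i : ℂ)) * U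

theorem conjTranspose_transferOp_mul_self (g : ι ≃. μ) (c : ι → ℝ) (U : Matrix ι α ℂ) :
    (transferOp g c U)ᴴ * transferOp g c U =
      Uᴴ * diagonal (fun i => ((c i ^ 2 * domIndicator g i : ℝ) : ℂ)) * U := by
  classical
  have hg : (g.symm.toMatrix : Matrix μ ι ℂ)ᴴ = (g.toMatrix : Matrix ι μ ℂ) := by
    rw [conjTranspose, ← PEquiv.toMatrix_symm]
    ext i j
    simp [PEquiv.toMatrix_apply, apply_ite]
  calc (transferOp g c U)ᴴ * transferOp g c U
      = Uᴴ * (diagonal (fun i => (c i : ℂ)) *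
          ((g.toMatrix : Matrix ι μ ℂ) * (g.symm.toMatrix : Matrix μ ι ℂ)) *
          diagonal fun i => (c i : ℂ)) * U := by
        simp [transferOp, hg, Matrix.mul_assoc, diagonal_conjTranspose, Pi.star_def]
    _ = _ := by
        rw [toMatrix_mul_toMatrix_symm, diagonal_mul_diagonal, diagonal_mul_diagonal]
        congr! 4
        push_cast
        ring

theorem sum_transferOp_kronecker_mulVec_diag [Fintype α] [Fintype β] {U : Matrix ι α ℂ}
    {V : Matrix ι β ℂ} (hU : U * Uᴴ = 1) (hV : V * Vᴴ = 1) (g : ι ≃. μ) (c c' x : ι → ℝ) :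
    ∑ r, ((transferOp g c U ⊗ₖ transferOp g c' V) *ᵥ
      vec (Vᴴ * diagonal (fun i => (x i : ℂ)) * (Uᴴ)ᵀ)) (r, r) =
        ((∑ i, domIndicator g i * (c i * c' i * x i) : ℝ) : ℂ) := by
  classical
  have hU' : (Uᴴ)ᵀ * Uᵀ = 1 := by rw [← transpose_mul, hU, transpose_one]
  rw [kronecker_mulVec_vec]
  calc _ = (transferOp g c' V * (Vᴴ * diagonal (fun i => (x i : ℂ)) * (Uᴴ)ᵀ) *
        (transferOp g c U)ᵀ).trace := rfl
    _ = ((g.symm.toMatrix : Matrix μ ι ℂ) * (diagonal (fun i => (c' i : ℂ)) * (V * Vᴴ) *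
          diagonal (fun i => (x i : ℂ)) * ((Uᴴ)ᵀ * Uᵀ) * diagonal (fun i => (c i : ℂ)) *
            (g.toMatrix : Matrix ι μ ℂ))).trace := by
        simp only [transferOp, transpose_mul, diagonal_transpose, ← PEquiv.toMatrix_symm,
          PEquiv.symm_symm, Matrix.mul_assoc]
    _ = _ := by
        rw [hV, hU', trace_mul_comm, Matrix.mul_assoc _ g.toMatrix, toMatrix_mul_toMatrix_symm]
        simp only [Matrix.mul_one, diagonal_mul_diagonal, trace_diagonal]
        push_cast
        exact Finset.sum_congr rfl fun i _ => by ring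

end Transfer

section Protocol

variable {ι α β μ σ : Type} [Fintype ι] [Fintype σ]

theorem sum_mul_sq_le_sum_sq_domIndicator {l : σ → ℝ} (hl : ∀ s, 0 ≤ l s)
    (hl' : ∑ s, l s = 1) {g : σ → ι ≃. μ} {w : ι → ℝ}
    (hw : ∀ i, ∑ s, l s * domIndicator (g s) i = w i ^ 2) (x : ι → ℝ) :
    (∑ i, w i * x i) ^ 2 ≤ ∑ s, (∑ i, domIndicator (g s) i * (√(l s) / w i * 1 * x i)) ^ 2 :=
  calc (∑ i, w i * x i) ^ 2
      = (∑ s, l s * ∑ i, domIndicator (g s) i * (x i / w i)) ^ 2 := by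
        simp only [Finset.mul_sum, ← mul_assoc]
        rw [Finset.sum_comm]
        simp only [← Finset.sum_mul, hw]
        congr! 2 with i
        rcases eq_or_ne (w i) 0 with h | h
        · simp [h]
        · field_simp
    _ ≤ ∑ s, l s * (∑ i, domIndicator (g s) i * (x i / w i)) ^ 2 :=
        Real.pow_arith_mean_le_arith_mean_pow_of_even _ _ _ (fun s _ => hl s) hl' even_two
    _ = _ := by
        congr! 1 with s
        rw [← Real.sq_sqrt (hl s), ← mul_pow, Finset.mul_sum, Real.sqrt_sq (Real.sqrt_nonneg _)]
        congr! 2 with i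
        ring

variable [DecidableEq ι] [Fintype α]

theorem sum_conjTranspose_transferOp_mul_self_le_one [DecidableEq α] [Fintype μ]
    {U : Matrix ι α ℂ} (hU : U * Uᴴ = 1) {l : σ → ℝ} (hl : ∀ s, 0 ≤ l s) {g : σ → ι ≃. μ}
    {w : ι → ℝ} (hw : ∀ i, ∑ s, l s * domIndicator (g s) i = w i ^ 2) :
    ∑ s, (transferOp (g s) (fun i => √(l s) / w i) U)ᴴ *
      transferOp (g s) (fun i => √(l s) / w i) U ≤ 1 := by
  have h (i : ι) : ∑ s, (√(l s) / w i) ^ 2 * domIndicator (g s) i = w i ^ 2 / w i ^ 2 := by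
    simp only [div_pow, Real.sq_sqrt (hl _), div_mul_eq_mul_div, ← Finset.sum_div, hw]
  simp only [conjTranspose_transferOp_mul_self]
  rw [← Matrix.sum_mul, ← Matrix.mul_sum]
  convert conjTranspose_mul_diagonal_mul_le_one hU fun i => div_self_le_one (w i ^ 2) using 4
  ext i j
  rcases eq_or_ne i j with rfl | hij
  · simp only [Matrix.sum_apply, diagonal_apply_eq, ← h]
    push_cast
    rfl
  · simp [Matrix.sum_apply, hij]

variable {a b m : ℕ}

theorem re_overlap_kraus_transferOp [Fintype β] {U : Matrix ι α ℂ} {V : Matrix ι β ℂ}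
    (hU : U * Uᴴ = 1) (hV : V * Vᴴ = 1) (g : ι ≃. Fin m) (c c' x : ι → ℝ) :
    (overlap m (kraus (transferOp g c U ⊗ₖ transferOp g c' V)
      (proj (vec (Vᴴ * diagonal (fun i => (x i : ℂ)) * (Uᴴ)ᵀ))))).re =
        1 / m * (∑ i, domIndicator g i * (c i * c' i * x i)) ^ 2 := by
  rw [kraus_proj, overlap_proj, sum_transferOp_kronecker_mulVec_diag hU hV, Complex.norm_real,
    ← Complex.ofReal_pow, Real.norm_eq_abs, sq_abs, ← Complex.ofReal_natCast, ← Complex.ofReal_one,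
    ← Complex.ofReal_div, ← Complex.ofReal_mul, Complex.ofReal_re]

theorem exists_isOneWayLOCC_le_re_overlap [NeZero m] {U : Matrix ι (Fin a) ℂ}
    {V : Matrix ι (Fin b) ℂ} (hU : U * Uᴴ = 1) (hV : V * Vᴴ = 1) {w : ι → ℝ} (hw₀ : ∀ i, 0 ≤ w i)
    (hw₁ : ∀ i, w i ≤ 1) (hw : ∑ i, w i ^ 2 ≤ m) (x : ι → ℝ) :
    ∃ Λ : MatMap (Fin a × Fin b) (Fin m × Fin m), IsOneWayLOCC Λ ∧ 1 / m * (∑ i, w i * x i) ^ 2 ≤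
      (overlap m (Λ (proj (vec (Vᴴ * diagonal (fun i => (x i : ℂ)) * (Uᴴ)ᵀ))))).re := by
  set ψ := vec (Vᴴ * diagonal (fun i => (x i : ℂ)) * (Uᴴ)ᵀ)
  obtain ⟨σ, _, l, z, hl, hl', hz, hlz⟩ := mem_convexHull_iff_exists_fintype.mp
    (mem_convexHull_range_domIndicator (μ := Fin m) (fun i => sq_nonneg (w i))
      (fun i => pow_le_one₀ (hw₀ i) (hw₁ i)) (by simpa using hw))
  choose g hg using hz
  have hlg (i : ι) : ∑ s, l s * domIndicator (g s) i = w i ^ 2 := by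
    simpa [hg] using congrFun hlz i
  have hV' (s : σ) : (transferOp (g s) 1 V)ᴴ * transferOp (g s) 1 V ≤ 1 := by
    rw [conjTranspose_transferOp_mul_self]
    exact conjTranspose_mul_diagonal_mul_le_one hV fun i => by
      simpa using domIndicator_le_one (g s) i
  obtain ⟨Λ, hΛ, hle⟩ := exists_isOneWayLOCC_sum_kraus_kronecker_le
    (sum_conjTranspose_transferOp_mul_self_le_one hU hl hlg) hV'
  have hoverlap := overlap_nonneg (le_iff.mp (hle (proj ψ) (posSemidef_proj ψ)))
  rw [map_sub, sub_nonneg] at hoverlap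
  refine ⟨Λ, hΛ, le_trans ?_ (Complex.le_def.mp hoverlap).1⟩
  simp only [map_sum, Complex.re_sum, ψ, re_overlap_kraus_transferOp hU hV, ← Finset.mul_sum]
  gcongr
  exact sum_mul_sq_le_sum_sq_domIndicator hl hl' hlg x

end Protocol

section Schmidt

theorem of_star_mul_conjTranspose_eq_one {ι α : Type*} [DecidableEq ι] [Fintype α]
    {e : ι → EuclideanSpace ℂ α} (he : Orthonormal ℂ e) :
    (of fun i p => star (e i p)) * (of fun i p => star (e i p))ᴴ = (1 : Matrix ι ι ℂ) := by
  ext i j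
  rw [one_apply, ← orthonormal_iff_ite.mp he i j, PiLp.inner_apply]
  simp [Matrix.mul_apply, mul_comm]

theorem eq_vec_mul_diagonal_mul {ι α β : Type*} [Fintype ι] [DecidableEq ι] {e : ι → α → ℂ}
    {f : ι → β → ℂ} {x : ι → ℂ} {ψ : α × β → ℂ} (hψ : ∀ p, ψ p = ∑ i, x i * (e i p.1 * f i p.2)) :
    ψ = vec ((of fun i q => star (f i q))ᴴ * diagonal x * ((of fun i p => star (e i p))ᴴ)ᵀ) := by
  ext p
  rw [hψ, vec, Matrix.mul_apply]
  refine Finset.sum_congr rfl fun i _ => ?_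
  rw [mul_diagonal]
  simp only [conjTranspose_apply, transpose_apply, of_apply, star_star]
  ring

end Schmidt

end Distillation

open Distillation in
theorem mainTheorem1_general {a b d m : ℕ} (hm : 1 ≤ m) {e : Fin d → EuclideanSpace ℂ (Fin a)}
    {f : Fin d → EuclideanSpace ℂ (Fin b)} (he : Orthonormal ℂ e) (hf : Orthonormal ℂ f)
    {ξ : Fin d → ℝ} (hξ : ∀ i, 0 ≤ ξ i) {ψ : Fin a × Fin b → ℂ}
    (hψ : ∀ p, ψ p = ∑ i, (ξ i : ℂ) * (e i p.1 * f i p.2)) (O : OpClass) :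
    fidelity O (proj ψ) m = 1 / (m : ℝ) * distNorm m (fun i => (ξ i : ℂ)) ^ 2 := by
  have : NeZero m := ⟨by lia⟩
  have hupper (Λ : MatMap (Fin a × Fin b) (Fin m × Fin m)) (hΛ : O.Mem Λ) :
      (overlap m (Λ (proj ψ))).re ≤ 1 / m * distNorm m (fun i => (ξ i : ℂ)) ^ 2 :=
    hΛ.mapsProductToRains.re_overlap_le hm he hf hψ
  obtain ⟨w, hw₀, hw₁, hw, hdist⟩ := exists_distNorm_le_sum_mul hm hξ
  obtain ⟨Λ, hΛ, hlower⟩ := exists_isOneWayLOCC_le_re_overlap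
    (of_star_mul_conjTranspose_eq_one he) (of_star_mul_conjTranspose_eq_one hf) hw₀ hw₁ hw ξ
  rw [← eq_vec_mul_diagonal_mul hψ] at hlower
  have hΛO := OpClass.mem_of_isOneWayLOCC hΛ O
  refine IsGreatest.csSup_eq ⟨⟨Λ, hΛO, ?_⟩, ?_⟩
  · rw [re_trace_conjTranspose_mul_proj_maxEntVec]
    refine le_antisymm (le_trans ?_ hlower) (hupper Λ hΛO)
    gcongr
    exact distNorm_nonneg _
  · rintro _ ⟨Λ, hΛ, rfl⟩
    rw [re_trace_conjTranspose_mul_proj_maxEntVec]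
    exact hupper Λ hΛ

theorem mainTheorem1 {a b : ℕ} (ψ : EuclideanSpace ℂ (Fin a × Fin b)) (hψ : ‖ψ‖ = 1)
    (ξ : Fin (min a b) → ℝ) (hξ : Distillation.IsSchmidtVector ψ ξ)
    (m : ℕ) (hm : 1 ≤ m) (O : Distillation.OpClass) :
    Distillation.fidelity O (Distillation.proj ψ) m =
      1 / (m : ℝ) * Distillation.distNorm m (fun i => (ξ i : ℂ)) ^ 2 := by
  obtain ⟨e, f, he, hf, hξ₀, hψξ⟩ := hξ
  exact mainTheorem1_general hm he hf hξ₀ hψξ O
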